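/- All graphs are finite and simple. For a graph $G$ let $\lambda_{\max}(G)$ and $\lambda_{\min}(G)$ be the largest and smallest eigenvalue of its adjacency matrix; if $G$ has at least one edge, its Hoffman bound is $h(G)=1-\lambda_{\max}(G)/\lambda_{\min}(G)$. A graph with at least one edge is Hoffman colorable if $\chi(G)=h(G)$, and it is non-trivially Hoffman colorable if moreover it is neither bipartite nor a regular complete multipartite graph $K_{m,\dots,m}$. For a graph $H$ on vertices $v_1,\dots,v_n$ and non-negative integers $a_1,\dots,a_n$, the generalized line graph $L(H;a_1,\dots,a_n)$ is obtained from the disjoint union of the line graph $L(H)$ and complete multipartite graphs $CP_1,\dots,CP_n$, where $CP_i$ has $a_i$ classes of size $2$, by joining every vertex of $CP_i$ to every edge of $H$ incident to $v_i$, for each $i$. Let $E_8\subset\mathbb Z^8$ be the root system consisting of the 112 vectors with two coordinates $\pm2$ and six coordinates $0$, and the 128 vectors with all coordinates $\pm1$ and an even number of coordinates $+1$. A graph is $E_8$-representable if there is an injective map from its vertex set to $E_8$ that sends adjacent vertices to vectors with inner product $4$ and distinct non-adjacent vertices to vectors with inner product $0$. A graph is exceptional if it is connected, $E_8$-representable,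 and not isomorphic to a generalized line graph. For $n\in\{6,7,8\}$, the Dynkin graph $E_n$ is the graph consisting of a path on the $n-1$ vertices $p_0,p_1,\dots,p_{n-2}$ and one further vertex adjacent only to $p_2$. Theorem. Let $G$ be an exceptional graph with $\lambda_{\min}(G)>-2$. Then $G$ is not non-trivially Hoffman colorable. Moreover, $G$ has at most $8$ vertices, and $h(G)$ is an integer if and only if $G$ is isomorphic to one of the Dynkin graphs $E_6$, $E_7$, $E_8$. These three graphs are indeed exceptional with smallest eigenvalue greater than $-2$, and they are bipartite. -/

import Mathlib

namespace HoffmanColoring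

open SimpleGraph

section Spectral

variable {V : Type*} [Fintype V] [DecidableEq V] (G : SimpleGraph V) [DecidableRel G.Adj]

/-- The largest eigenvalue of the adjacency matrix of `G` (for a nonempty vertex set). -/
noncomputable def lambdaMax : ℝ := sSup (spectrum ℝ (G.adjMatrix ℝ))

/-- The smallest eigenvalue of the adjacency matrix of `G` (for a nonempty vertex set). -/
noncomputable def lambdaMin : ℝ := sInf (spectrum ℝ (G.adjMatrix ℝ))

/-- The Hoffman bound `h(G) = 1 - λ_max(G) / λ_min(G)` (meaningful when `G` has an edge). -/
noncomputable def hoffmanBound : ℝ := 1 - lambdaMax G / lambdaMin G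

/-- `G` has an edge and its chromatic number equals its Hoffman bound. -/
def IsHoffmanColorable : Prop :=
  G ≠ ⊥ ∧ ∃ k : ℕ, G.chromaticNumber = (k : ℕ∞) ∧ (k : ℝ) = hoffmanBound G

/-- `G` is Hoffman colorable, but neither bipartite nor a regular complete multipartite graph
`K_{m, …, m}`. -/
def IsNontriviallyHoffmanColorable : Prop :=
  IsHoffmanColorable G ∧ ¬ G.IsBipartite ∧
    ¬ ∃ r m : ℕ, Nonempty (G ≃g completeEquipartiteGraph r m)

end Spectral

/-- The generalized line graph `L(H; a)`: the disjoint union of the line graph `L(H)` and, for every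
vertex `w` of `H`, a cocktail party graph with `a w` classes of size two (the vertex
`⟨w, i, b⟩` is the element `b` of class `i`), where every vertex of the cocktail party graph at `w`
is joined to every edge of `H` incident to `w`. -/
def generalizedLineGraph {W : Type*} (H : SimpleGraph W) (a : W → ℕ) :
    SimpleGraph (H.edgeSet ⊕ (Σ w : W, Fin (a w) × Bool)) where
  Adj x y :=
    match x, y with
    | .inl e, .inl f => H.lineGraph.Adj e f
    | .inl e, .inr p => p.1 ∈ (e : Sym2 W)
    | .inr p, .inl e => p.1 ∈ (e : Sym2 W)
    | .inr p, .inr q => p.1 = q.1 ∧ (p.2.1 : ℕ) ≠ (q.2.1 : ℕ)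
  symm := ⟨by
    rintro (e | p) (f | q) h
    · exact SimpleGraph.Adj.symm (G := H.lineGraph) h
    · exact h
    · exact h
    · exact ⟨h.1.symm, h.2.symm⟩⟩
  loopless := ⟨by
    rintro (e | p) h
    · exact H.lineGraph.loopless.irrefl e h
    · exact h.2 rfl⟩

/-- `G` is (isomorphic to) a generalized line graph of some finite graph. -/
def IsGeneralizedLineGraph {V : Type*} (G : SimpleGraph V) : Prop :=
  ∃ (n : ℕ) (H : SimpleGraph (Fin n)) (a : Fin n → ℕ), Nonempty (G ≃g generalizedLineGraph H a)

/-- The `E₈` root system, scaled to lie in `ℤ⁸`: the 112 vectors with two coordinates `±2` and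
six coordinates `0`, and the 128 vectors with all coordinates `±1` and an even number of `+1`'s
(equivalently, an even number of `-1`'s). -/
def rootsE8 : Set (Fin 8 → ℤ) :=
  {x | (∃ i j, i ≠ j ∧ (x i = 2 ∨ x i = -2) ∧ (x j = 2 ∨ x j = -2) ∧
          ∀ k, k ≠ i → k ≠ j → x k = 0) ∨
       ((∀ i, x i = 1 ∨ x i = -1) ∧ Even (Finset.univ.filter fun i => x i = 1).card)}

/-- `G` admits an `E₈`-representation: adjacent vertices go to roots with inner product 4 (angle
60°), distinct non-adjacent vertices to roots with inner product 0 (angle 90°). -/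
def IsE8Representable {V : Type*} (G : SimpleGraph V) : Prop :=
  ∃ f : V → Fin 8 → ℤ, Function.Injective f ∧ (∀ v, f v ∈ rootsE8) ∧
    (∀ u v, G.Adj u v → f u ⬝ᵥ f v = 4) ∧ (∀ u v, u ≠ v → ¬ G.Adj u v → f u ⬝ᵥ f v = 0)

/-- A graph is exceptional if it is connected, `E₈`-representable, and not a generalized line
graph. -/
def IsExceptional {V : Type*} (G : SimpleGraph V) : Prop :=
  G.Connected ∧ IsE8Representable G ∧ ¬ IsGeneralizedLineGraph G

/-- The Dynkin graph `E_n` (for `n = 6, 7, 8`): the path `0 - 1 - ⋯ - (n - 2)` together with one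
further vertex `n - 1` that is joined to the vertex `2` only. -/
def dynkinE (n : ℕ) : SimpleGraph (Fin n) :=
  SimpleGraph.fromRel fun i j : Fin n =>
    ((j : ℕ) = i + 1 ∧ (j : ℕ) + 1 < n) ∨ ((i : ℕ) = 2 ∧ (j : ℕ) + 1 = n)

instance (n : ℕ) : DecidableRel (dynkinE n).Adj :=
  inferInstanceAs (DecidableRel (SimpleGraph.fromRel fun i j : Fin n =>
    ((j : ℕ) = i + 1 ∧ (j : ℕ) + 1 < n) ∨ ((i : ℕ) = 2 ∧ (j : ℕ) + 1 = n)).Adj)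

end HoffmanColoring

/-! The Gram matrix of an `E₈`-representation is `4A + 8I`. When `λ_min > -2` it is positive
definite, so the vertices are represented by linearly independent vectors of `ℝ⁸` and `G` has at
most 8 vertices. An exceptional graph is not complete, because complete graphs are line graphs of
stars; being connected, it contains an induced path on three vertices, so `λ_min < -1`.

Write `θ = λ_min`. If `h(G)` is an integer, then `λ_max = -kθ` with `k = h(G) - 1` a positive
integer.

If `k = 1`, then `λ_max < 2`. The connected graphs with this property are the paths, the `D_n` and
`E₆, E₇, E₈`; the first two families consist of generalized line graphs.

If `k ≥ 2`, arithmetic decides. For every conjugate `x` of `θ`, both `x` and `-kx` are eigenvalues,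
hence real and greater than `-2`; so `-2 < x < 1`. On this interval `x(x+1)(x+2)(x-1)(x²+x-1)` is
less than 1 in absolute value, so its value at `θ` is an algebraic integer whose norm is an integer
of absolute value less than 1, that is, 0. As `-2 < θ < -1`, this leaves `θ² + θ - 1 = 0`, so `θ =
-φ` with `φ` the golden ratio. Applying `-kx ≥ θ` to the conjugate `x = 1/φ` gives `k ≤ φ² < 3`.
Hence `λ_min = -φ` and `λ_max = 2φ` (`golden_of_scaled_conjugates`), and a search through the
connected graphs with at most 8 vertices and eigenvalues in a slightly larger range finds only
generalized line graphs.

So integrality of `h(G)` leaves only `E₆, E₇, E₈`. They are bipartite, so their Hoffman bound is 2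
and they are not non-trivially Hoffman colorable. Both searches (`exists_isCoded_of_connected`) add
one vertex at a time and discard graphs containing an obstruction, checked by kernel evaluation. -/

namespace HoffmanColoring

open SimpleGraph Matrix

/-! ### Extreme eigenvalues as bounds on quadratic forms -/

section Rayleigh

variable {V : Type*} [Fintype V] [DecidableEq V] (G : SimpleGraph V) [DecidableRel G.Adj]

omit [Fintype V] [DecidableEq V] in
theorem adjMatrix_isHermitian : (G.adjMatrix ℝ).IsHermitian := by
  rw [Matrix.IsHermitian, Matrix.conjTranspose_eq_transpose_of_trivial, G.transpose_adjMatrix]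

theorem lambdaMin_mem_spectrum [Nonempty V] : lambdaMin G ∈ spectrum ℝ (G.adjMatrix ℝ) := by
  refine Set.Nonempty.csInf_mem ?_ Matrix.finite_real_spectrum
  exact ⟨_, (adjMatrix_isHermitian G).eigenvalues_mem_spectrum_real (Classical.arbitrary V)⟩

theorem lambdaMax_mem_spectrum [Nonempty V] : lambdaMax G ∈ spectrum ℝ (G.adjMatrix ℝ) := by
  refine Set.Nonempty.csSup_mem ?_ Matrix.finite_real_spectrum
  exact ⟨_, (adjMatrix_isHermitian G).eigenvalues_mem_spectrum_real (Classical.arbitrary V)⟩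

theorem lambdaMin_le {μ : ℝ} (h : μ ∈ spectrum ℝ (G.adjMatrix ℝ)) : lambdaMin G ≤ μ :=
  csInf_le Matrix.finite_real_spectrum.bddBelow h

theorem le_lambdaMax {μ : ℝ} (h : μ ∈ spectrum ℝ (G.adjMatrix ℝ)) : μ ≤ lambdaMax G :=
  le_csSup Matrix.finite_real_spectrum.bddAbove h

theorem lambdaMin_mul_le (x : V → ℝ) :
    lambdaMin G * (x ⬝ᵥ x) ≤ x ⬝ᵥ (G.adjMatrix ℝ) *ᵥ x := by
  have h : (G.adjMatrix ℝ - algebraMap ℝ _ (lambdaMin G)).PosSemidef := by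
    rw [Matrix.posSemidef_iff_isHermitian_and_spectrum_nonneg]
    refine ⟨(adjMatrix_isHermitian G).sub ?_, ?_⟩
    · rw [Matrix.IsHermitian, Matrix.conjTranspose_eq_transpose_of_trivial,
        Matrix.algebraMap_eq_diagonal, Matrix.diagonal_transpose]
    · intro μ hμ
      rw [← spectrum.sub_singleton_eq] at hμ
      obtain ⟨a, ha, b, rfl, rfl⟩ := hμ
      exact sub_nonneg.2 (lambdaMin_le G ha)
  have := h.dotProduct_mulVec_nonneg x
  rw [Algebra.algebraMap_eq_smul_one, Matrix.sub_mulVec, dotProduct_sub, Matrix.smul_mulVec,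
    Matrix.one_mulVec, dotProduct_smul] at this
  simpa using this

theorem le_lambdaMax_mul (x : V → ℝ) :
    x ⬝ᵥ (G.adjMatrix ℝ) *ᵥ x ≤ lambdaMax G * (x ⬝ᵥ x) := by
  have h : (algebraMap ℝ _ (lambdaMax G) - G.adjMatrix ℝ).PosSemidef := by
    rw [Matrix.posSemidef_iff_isHermitian_and_spectrum_nonneg]
    refine ⟨Matrix.IsHermitian.sub ?_ (adjMatrix_isHermitian G), ?_⟩
    · rw [Matrix.IsHermitian, Matrix.conjTranspose_eq_transpose_of_trivial,
        Matrix.algebraMap_eq_diagonal, Matrix.diagonal_transpose]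
    · intro μ hμ
      rw [← spectrum.singleton_sub_eq] at hμ
      obtain ⟨a, rfl, b, hb, rfl⟩ := hμ
      exact sub_nonneg.2 (le_lambdaMax G hb)
  have := h.dotProduct_mulVec_nonneg x
  rw [Algebra.algebraMap_eq_smul_one, Matrix.sub_mulVec, dotProduct_sub, Matrix.smul_mulVec,
    Matrix.one_mulVec, dotProduct_smul] at this
  simpa using this

theorem lambdaMin_gt_of_forall {c : ℝ} [Nonempty V]
    (h : ∀ x : V → ℝ, x ≠ 0 → c * (x ⬝ᵥ x) < x ⬝ᵥ (G.adjMatrix ℝ) *ᵥ x) : c < lambdaMin G := by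
  have h1 := lambdaMin_mem_spectrum G
  rw [← Matrix.spectrum_toLin', ← Module.End.hasEigenvalue_iff_mem_spectrum] at h1
  obtain ⟨x, hx⟩ := h1.exists_hasEigenvector
  have h2 := h x hx.2
  have h3 : (G.adjMatrix ℝ) *ᵥ x = lambdaMin G • x := by
    rw [← Matrix.toLin'_apply]; exact hx.apply_eq_smul
  rw [h3, dotProduct_smul, smul_eq_mul] at h2
  have h4 : 0 ≤ x ⬝ᵥ x := by simpa using dotProduct_star_self_nonneg x
  exact lt_of_mul_lt_mul_right h2 h4

/-- Extending a vector by zero transfers quadratic forms from induced subgraphs to `G`; this is the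
part of eigenvalue interlacing that is needed. -/
theorem exists_dotProduct_mulVec_adjMatrix {ι : Type*} [Fintype ι] {f : ι → V}
    (hf : Function.Injective f) (x : ι → ℝ) :
    ∃ y : V → ℝ, y ⬝ᵥ y = ∑ i, x i * x i ∧ y ⬝ᵥ (G.adjMatrix ℝ) *ᵥ y =
      ∑ i, ∑ j, if G.Adj (f i) (f j) then x i * x j else 0 := by
  classical
  refine ⟨∑ i, Pi.single (f i) (x i), ?_, ?_⟩
  · simp only [sum_dotProduct, dotProduct_sum, single_dotProduct, Pi.single_apply, hf.eq_iff]
    simp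
  · simp only [sum_dotProduct, Matrix.mulVec_sum, dotProduct_sum, single_dotProduct,
      Matrix.mulVec_single]
    refine Finset.sum_congr rfl fun i _ => Finset.sum_congr rfl fun j _ => ?_
    simp [adjMatrix_apply, G.adj_comm (f j), mul_comm (x j)]

/-- The integral quadratic form `p |x|² + q xᵀ A x` is positive definite on every set of
vertices of `G`. -/
def FormPos {V : Type*} (G : SimpleGraph V) [DecidableRel G.Adj] (p q : ℤ) : Prop :=
  ∀ (k : ℕ) (f : Fin k → V), Function.Injective f → ∀ x : Fin k → ℤ, x ≠ 0 →
    0 < p * ∑ i, x i * x i + q * ∑ i, ∑ j, if G.Adj (f i) (f j) then x i * x j else 0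

omit [Fintype V] [DecidableEq V] in
theorem FormPos.induce {p q : ℤ} (h : FormPos G p q) (s : Set V) : FormPos (G.induce s) p q := by
  intro k f hf x hx
  simpa using h k (fun i => f i) (Subtype.val_injective.comp hf) x hx

theorem sum_mul_self_pos {k : ℕ} {x : Fin k → ℤ} (hx : x ≠ 0) : 0 < ∑ i, x i * x i := by
  obtain ⟨i, hi⟩ := Function.ne_iff.1 hx
  exact Finset.sum_pos' (fun j _ => mul_self_nonneg _)
    ⟨i, Finset.mem_univ _, mul_self_pos.2 hi⟩

/-- A rational bound `-p/q < λ_min` becomes a condition on integral vectors, which one explicit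
vector on a subgraph can refute by integer arithmetic. -/
theorem formPos_of_neg_lambdaMin_lt {p q : ℤ} (hq : 0 < q) (h : 0 < p + q * lambdaMin G) :
    FormPos G p q := by
  intro k f hf x hx
  obtain ⟨y, hy1, hy2⟩ := exists_dotProduct_mulVec_adjMatrix G hf (fun i => (x i : ℝ))
  have h1 := lambdaMin_mul_le G y
  have h2 : (0 : ℝ) < ∑ i, (x i : ℝ) * x i := by exact_mod_cast sum_mul_self_pos hx
  rw [hy1, hy2] at h1
  rw [← Int.cast_pos (R := ℝ)]
  push_cast
  have h3 : (0 : ℝ) < q := by exact_mod_cast hq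
  have h4 := mul_le_mul_of_nonneg_left h1 h3.le
  have h5 := mul_pos h h2
  linarith

theorem formPos_of_lambdaMax_lt {p q : ℤ} (hq : q < 0) (h : 0 < p + q * lambdaMax G) :
    FormPos G p q := by
  intro k f hf x hx
  obtain ⟨y, hy1, hy2⟩ := exists_dotProduct_mulVec_adjMatrix G hf (fun i => (x i : ℝ))
  have h1 := le_lambdaMax_mul G y
  have h2 : (0 : ℝ) < ∑ i, (x i : ℝ) * x i := by exact_mod_cast sum_mul_self_pos hx
  rw [hy1, hy2] at h1
  rw [← Int.cast_pos (R := ℝ)]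
  push_cast
  have h3 : (q : ℝ) < 0 := by exact_mod_cast hq
  have h4 := mul_le_mul_of_nonpos_left h1 h3.le
  have h5 := mul_pos h h2
  linarith

theorem one_le_lambdaMax {u v : V} (h : G.Adj u v) : 1 ≤ lambdaMax G := by
  have hf : Function.Injective ![u, v] := by
    intro i j; fin_cases i <;> fin_cases j <;> simp [h.ne, h.ne.symm]
  obtain ⟨y, hy1, hy2⟩ := exists_dotProduct_mulVec_adjMatrix G hf ![1, 1]
  have h1 := le_lambdaMax_mul G y
  rw [hy1, hy2] at h1
  simp [Fin.sum_univ_two, h, h.symm] at h1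
  linarith

theorem lambdaMin_lt_neg_one_of_induced_path {u v w : V} (huv : G.Adj u v) (hvw : G.Adj v w)
    (hne : u ≠ w) (huw : ¬ G.Adj u w) : lambdaMin G < -1 := by
  have hf : Function.Injective ![u, v, w] := by
    intro i j
    fin_cases i <;> fin_cases j <;> simp [huv.ne, huv.ne.symm, hvw.ne, hvw.ne.symm, hne, hne.symm]
  -- This vector has Rayleigh quotient `-4/3` on the induced path.
  obtain ⟨y, hy1, hy2⟩ := exists_dotProduct_mulVec_adjMatrix G hf ![1, -1, 1]
  have h1 := lambdaMin_mul_le G y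
  rw [hy1, hy2] at h1
  simp [Fin.sum_univ_three, huv, huv.symm, hvw, hvw.symm, huw, G.adj_comm w u] at h1
  linarith

/-- A connected graph whose smallest eigenvalue is at least `-1` is complete. -/
theorem eq_top_of_neg_one_le_lambdaMin (hG : G.Connected) (h : -1 ≤ lambdaMin G) : G = ⊤ := by
  -- Adjacency propagates along walks, since otherwise an induced path on three vertices appears.
  have key : ∀ u v : V, G.Reachable u v → u ≠ v → G.Adj u v := by
    rintro u v ⟨p⟩
    induction p with
    | nil => exact fun h => (h rfl).elim
    | @cons a b c hab p ih =>
      intro hac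
      by_cases hbc : b = c
      · exact hbc ▸ hab
      · by_contra hn
        exact absurd h (not_le.2
          (lambdaMin_lt_neg_one_of_induced_path G hab (ih hbc) hac hn))
  ext u v
  exact ⟨fun h => h.ne, fun h => key u v (hG.preconnected u v) h⟩

/-- Conjugation by the diagonal matrix of signs of a 2-coloring turns `A` into `-A`, so the spectrum
is symmetric. -/
theorem lambdaMax_eq_neg_lambdaMin (h : G.IsBipartite) : lambdaMax G = - lambdaMin G := by
  obtain ⟨c⟩ := h
  let D : Matrix V V ℝ := Matrix.diagonal fun v => if c v = 0 then 1 else -1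
  have hD : D * D = 1 := by
    rw [Matrix.diagonal_mul_diagonal, ← Matrix.diagonal_one]
    congr 1; ext v; split_ifs <;> simp
  let u : (Matrix V V ℝ)ˣ := ⟨D, D, hD, hD⟩
  have hc : (u : Matrix V V ℝ) * G.adjMatrix ℝ * (u⁻¹ : (Matrix V V ℝ)ˣ) = - G.adjMatrix ℝ := by
    change D * G.adjMatrix ℝ * D = _
    ext v w
    rw [Matrix.mul_diagonal, Matrix.diagonal_mul, Matrix.neg_apply, adjMatrix_apply]
    by_cases hvw : G.Adj v w
    · have := c.valid hvw
      have h1 : ∀ a : Fin 2, a = 0 ∨ a = 1 := by decide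
      rcases h1 (c v) with h2 | h2 <;> rcases h1 (c w) with h3 | h3 <;> simp_all
    · simp [hvw]
  have hs : spectrum ℝ (G.adjMatrix ℝ) = - spectrum ℝ (G.adjMatrix ℝ) := by
    rw [spectrum.neg_eq, ← hc, spectrum.units_conjugate]
  rw [lambdaMax, lambdaMin, Real.sInf_def, neg_neg, ← hs]

end Rayleigh

/-! ### Generating connected graphs vertex by vertex, with bit-coded graphs -/

section Growth

/-- Adjacency in the graph on the numbers below `R.length` in which bit `i < j` of the entry `j`
of `R` tells whether `i` and `j` are adjacent. -/
def bitAdj (R : List ℕ) (i j : ℕ) : Bool :=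
  if i < j then (R.getD j 0).testBit i else if j < i then (R.getD i 0).testBit j else false

theorem bitAdj_of_lt {R : List ℕ} {i j : ℕ} (h : i < j) :
    bitAdj R i j = (R.getD j 0).testBit i := if_pos h

theorem bitAdj_of_gt {R : List ℕ} {i j : ℕ} (h : j < i) :
    bitAdj R i j = (R.getD i 0).testBit j := by
  rw [bitAdj, if_neg h.le.not_gt, if_pos h]

theorem bitAdj_self (R : List ℕ) (i : ℕ) : bitAdj R i i = false := by simp [bitAdj]

/-- The `k`-th bit of `n`, in a form that the kernel evaluates quickly. -/
def bitOf (n k : ℕ) : Bool := Nat.beq (Nat.land (Nat.shiftRight n k) 1) 1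

theorem bitOf_eq (n k : ℕ) : bitOf n k = n.testBit k := by
  have h : Nat.land (Nat.shiftRight n k) 1 = (n >>> k) % 2 := Nat.and_one_is_mod _
  rw [bitOf, h, Nat.testBit, Nat.one_and_eq_mod_two]
  rcases Nat.mod_two_eq_zero_or_one (n >>> k) with h | h <;> rw [h] <;> rfl

/-- The bits of `S` below `k`, moved to the column `n` of an `8 × 8` bit matrix. -/
def column (S n : ℕ) : ℕ → ℕ
  | 0 => 0
  | k + 1 => Nat.lor (column S n k)
      (bif bitOf S k then Nat.pow 2 (Nat.add (Nat.mul 8 k) n) else 0)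

theorem testBit_column {S n : ℕ} (hn : n < 8) : ∀ {k i j : ℕ}, j < 8 →
    (column S n k).testBit (8 * i + j) = (decide (i < k ∧ j = n) && S.testBit i)
  | 0, i, j, _ => by simp [column]
  | k + 1, i, j, hj => by
    have h : column S n (k + 1) =
      column S n k ||| (bif S.testBit k then 2 ^ (8 * k + n) else 0) := by
      rw [← bitOf_eq]; rfl
    rw [h, Nat.testBit_or, testBit_column hn hj]
    by_cases h1 : i = k
    · subst h1
      by_cases h2 : j = n
      · subst h2
        cases S.testBit i <;> simp
      · have h3 : 8 * i + n ≠ 8 * i + j := by omega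
        cases S.testBit i <;> simp [h2, Nat.testBit_two_pow_of_ne h3]
    · have h3 : 8 * k + n ≠ 8 * i + j := by omega
      have h4 : i < k + 1 ↔ i < k := by omega
      cases S.testBit k <;> simp [h4, Nat.testBit_two_pow_of_ne h3]

/-- The packed adjacency matrix after adding a vertex `n` joined to the vertices in `S`. -/
def addVertex (c n S : ℕ) : ℕ :=
  Nat.lor c (Nat.lor (Nat.shiftLeft S (Nat.mul 8 n)) (column S n n))

/-- `c` is the `8 × 8` adjacency matrix of the graph coded by `R`, packed into a number. -/
def Packs (c : ℕ) (R : List ℕ) : Prop :=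
  ∀ i < 8, ∀ j < 8, c.testBit (8 * i + j) =
    (decide (i < R.length ∧ j < R.length) && bitAdj R i j)

instance (c : ℕ) (R : List ℕ) : Decidable (Packs c R) := by unfold Packs; infer_instance

theorem bitAdj_append_singleton {R : List ℕ} {S i j : ℕ} (hi : i < R.length) (hj : j < R.length) :
    bitAdj (R ++ [S]) i j = bitAdj R i j := by
  simp [bitAdj, List.getElem?_append_left, hi, hj]

theorem Packs.addVertex {c : ℕ} {R : List ℕ} (hc : Packs c R) {S : ℕ} (hR : R.length < 8)
    (hS : S < 2 ^ R.length) : Packs (addVertex c R.length S) (R ++ [S]) := by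
  intro i hi j hj
  have h : HoffmanColoring.addVertex c R.length S =
    c ||| (S <<< (8 * R.length) ||| column S R.length R.length) := rfl
  have hlen : (R ++ [S]).length = R.length + 1 := by simp
  have hbig : ∀ k, R.length ≤ k → S.testBit k = false := fun k hk =>
    Nat.testBit_lt_two_pow (hS.trans_le (Nat.pow_le_pow_right two_pos hk))
  have hlast : (R ++ [S]).getD R.length 0 = S := by simp
  rw [h, Nat.testBit_or, Nat.testBit_or, hc i hi j hj, testBit_column hR hj, Nat.testBit_shiftLeft,
    hlen]
  rcases lt_trichotomy i R.length with hi' | hi' | hi'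
  · have h1 : ¬ 8 * R.length ≤ 8 * i + j := by omega
    rcases lt_trichotomy j R.length with hj' | hj' | hj'
    · rw [bitAdj_append_singleton hi' hj']
      simp [hi', hj', h1, hj'.ne, hi'.trans (Nat.lt_succ_self _), hj'.trans (Nat.lt_succ_self _)]
    · subst hj'
      rw [bitAdj_of_lt (R := R ++ [S]) hi', hlast]
      simp [hi', h1, hi'.trans (Nat.lt_succ_self _)]
    · have h2 : ¬ j < R.length + 1 := by omega
      simp [h1, h2, hj'.ne', hj'.not_gt]
  · subst hi'
    have h1 : 8 * R.length + j - 8 * R.length = j := by omega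
    rcases lt_trichotomy j R.length with hj' | hj' | hj'
    · rw [bitAdj_of_gt (R := R ++ [S]) hj', hlast]
      simp [h1, hj'.trans (Nat.lt_succ_self _)]
    · subst hj'
      simp [bitAdj_self, hbig]
    · have h2 : ¬ j < R.length + 1 := by omega
      simp [h2, h1, hbig j hj'.le]
  · have h1 : ¬ i < R.length + 1 := by omega
    have h2 : R.length ≤ 8 * i + j - 8 * R.length := by omega
    simp [h1, hi'.not_gt, hbig _ h2]

/-- The vertices in `full` that differ from all entries of `m`, and that are adjacent exactly to
those whose bit in `s` is set. The numbers `c` and `d` are the packed adjacency matrices of the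
graph and of its complement. -/
def candidates (c d full : ℕ) : ℕ → List ℕ → ℕ
  | _, [] => full
  | s, a :: m => Nat.land (Nat.shiftRight (bif bitOf s 0 then c else d) (Nat.mul 8 a))
      (candidates c d full (Nat.div s 2) m)

/-- Some bit of the number satisfies `p`; the first argument bounds the number of bits tried. -/
def anyBit (p : ℕ → Bool) : ℕ → ℕ → Bool
  | 0, _ => false
  | k + 1, s => bif Nat.beq s 0 then false else
      bif p (Nat.log2 s) then true else anyBit p k (Nat.xor s (Nat.pow 2 (Nat.log2 s)))

/-- The partial induced embedding `m` into the graph with packed adjacency matrix `c` extends by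
vertices with the adjacencies coded by a list. -/
def extendable (c d full : ℕ) : List ℕ → List ℕ → Bool
  | [], _ => true
  | s :: P, m => anyBit (fun v => extendable c d full P (m ++ [v])) 8 (candidates c d full s m)

/-- The packed adjacency matrix of the complement, if all 8 vertices are present. -/
def packedCompl (c : ℕ) : ℕ := Nat.xor c 0x7fbfdfeff7fbfdfe

/-- The graph with `n` vertices and packed adjacency matrix `c` has an induced subgraph coded
by `P`. -/
def containsCode (c n : ℕ) (P : List ℕ) : Bool :=
  extendable c (packedCompl c) (Nat.sub (Nat.pow 2 n) 1) P []

theorem testBit_packedCompl (c : ℕ) {i j : ℕ} (hi : i < 8) (hj : j < 8) :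
    (packedCompl c).testBit (8 * i + j) = (c.testBit (8 * i + j) ^^ decide (i ≠ j)) := by
  -- The mask has zeros exactly at the diagonal positions `9i`.
  have h : ∀ i < 8, ∀ j < 8, Nat.testBit 0x7fbfdfeff7fbfdfe (8 * i + j) = decide (i ≠ j) := by
    decide +kernel
  have h1 : packedCompl c = c ^^^ 0x7fbfdfeff7fbfdfe := rfl
  rw [h1, Nat.testBit_xor, h i hi j hj]

/-- Only soundness is needed: running out of the bound `k` returns `false`, which can make a check
fail but never succeed wrongly. -/
theorem exists_of_anyBit {p : ℕ → Bool} : ∀ {k s : ℕ}, anyBit p k s = true →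
    ∃ v, s.testBit v = true ∧ p v = true
  | 0, s, h => by simp [anyBit] at h
  | k + 1, s, h => by
    rw [anyBit] at h
    cases h0 : Nat.beq s 0 with
    | true => simp [h0] at h
    | false =>
      have hs : s ≠ 0 := by rintro rfl; simp at h0
      rw [h0, cond_false] at h
      cases h1 : p (Nat.log2 s) with
      | true => exact ⟨_, Nat.testBit_log2 hs, h1⟩
      | false =>
        rw [h1, cond_false] at h
        obtain ⟨v, hv, hp⟩ := exists_of_anyBit h
        refine ⟨v, ?_, hp⟩
        have hne : s.log2 ≠ v := by rintro rfl; simp [h1] at hp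
        have h2 : Nat.xor s (Nat.pow 2 (Nat.log2 s)) = s ^^^ 2 ^ s.log2 := rfl
        rw [h2, Nat.testBit_xor, Nat.testBit_two_pow_of_ne hne] at hv
        simpa using hv

theorem candidates_spec {R : List ℕ} {c v : ℕ} (hR : R.length ≤ 8) (hc : Packs c R) :
    ∀ {m : List ℕ} {s : ℕ}, (∀ a ∈ m, a < R.length) →
    (candidates c (packedCompl c) (2 ^ R.length - 1) s m).testBit v = true →
    v < R.length ∧ ∀ j (hj : j < m.length), m[j] ≠ v ∧ bitAdj R m[j] v = s.testBit j
  | [], s, _, h => by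
    rw [candidates, Nat.testBit_two_pow_sub_one] at h
    exact ⟨by simpa using h, fun j hj => by simp at hj⟩
  | a :: m, s, hm, h => by
    have h1 : candidates c (packedCompl c) (2 ^ R.length - 1) s (a :: m) =
      ((bif s.testBit 0 then c else packedCompl c) >>> (8 * a)) &&&
        candidates c (packedCompl c) (2 ^ R.length - 1) (s / 2) m := by
      rw [← bitOf_eq]; rfl
    rw [h1, Nat.testBit_and, Bool.and_eq_true] at h
    obtain ⟨hv, h2⟩ := candidates_spec hR hc (fun b hb => hm b (by simp [hb])) h.2
    refine ⟨hv, fun j hj => ?_⟩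
    cases j with
    | zero =>
      have ha : a < R.length := hm a (by simp)
      have h3 := hc a (by omega) v (by omega)
      have h4 := h.1
      rw [Nat.testBit_shiftRight] at h4
      change a ≠ v ∧ bitAdj R a v = s.testBit 0
      cases hs : s.testBit 0 with
      | true =>
        rw [hs, cond_true, h3] at h4
        have h5 : bitAdj R a v = true := by simpa [ha, hv] using h4
        refine ⟨?_, h5⟩
        rintro rfl
        simp [bitAdj_self] at h5
      | false =>
        rw [hs, cond_false, testBit_packedCompl c (by omega) (by omega), h3] at h4
        by_cases hav : a = v
        · subst hav; simp [bitAdj_self] at h4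
        · exact ⟨hav, by simpa [ha, hv, hav] using h4⟩
    | succ j =>
      have := h2 j (by simpa using hj)
      rw [Nat.testBit_succ]
      exact this

/-- Soundness of the backtracking search: `l` collects the images chosen after the partial embedding
`m`. -/
theorem extendable_spec {R : List ℕ} {c : ℕ} (hR : R.length ≤ 8) (hc : Packs c R) :
    ∀ {P m : List ℕ}, (∀ a ∈ m, a < R.length) →
    extendable c (packedCompl c) (2 ^ R.length - 1) P m = true →
    ∃ l : List ℕ, l.length = P.length ∧ (∀ v ∈ l, v < R.length) ∧
      ∀ i (hi : i < P.length), ∀ j < m.length + i,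
        (m ++ l).getD j 0 ≠ l.getD i 0 ∧
        bitAdj R ((m ++ l).getD j 0) (l.getD i 0) = P[i].testBit j
  | [], m, _, _ => ⟨[], rfl, by simp, by simp⟩
  | s :: P, m, hm, h => by
    obtain ⟨v, hcand, he⟩ := exists_of_anyBit h
    obtain ⟨hv, hf⟩ := candidates_spec hR hc hm hcand
    obtain ⟨l, hl, hlt, hl'⟩ := extendable_spec hR hc (m := m ++ [v]) (by
      intro a ha
      rcases List.mem_append.1 ha with ha | ha
      · exact hm a ha
      · rwa [List.mem_singleton.1 ha]) he
    refine ⟨v :: l, by simp [hl], by simpa using ⟨hv, hlt⟩, ?_⟩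
    intro i hi j hj
    cases i with
    | zero =>
      have hj' : j < m.length := by simpa using hj
      have := hf j hj'
      rw [List.getD_append _ _ _ _ hj', List.getD_eq_getElem _ _ hj']
      exact this
    | succ i =>
      have := hl' i (by simpa using hi) j (by simp; omega)
      simpa using this

/-- `f` is an induced embedding of the graph coded by `R` into `G`. -/
def IsCoded {V : Type*} (G : SimpleGraph V) (R : List ℕ) (f : ℕ → V) : Prop :=
  Set.InjOn f (Set.Iio R.length) ∧
    ∀ i < R.length, ∀ j < R.length, G.Adj (f i) (f j) ↔ bitAdj R i j = true

theorem IsCoded.of_lt {V : Type*} {G : SimpleGraph V} {R : List ℕ} {f : ℕ → V}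
    (h : ∀ i (hi : i < R.length), ∀ j < i, f j ≠ f i ∧ (G.Adj (f j) (f i) ↔ R[i].testBit j = true)) :
    IsCoded G R f := by
  constructor
  · intro i hi j hj hij
    by_contra hne
    rcases Nat.lt_or_gt_of_ne hne with hlt | hlt
    · exact (h j hj i hlt).1 hij
    · exact (h i hi j hlt).1 hij.symm
  · intro i hi j hj
    rcases lt_trichotomy i j with hlt | rfl | hlt
    · rw [bitAdj_of_lt hlt, List.getD_eq_getElem _ _ hj]; exact (h j hj i hlt).2
    · simp [bitAdj_self]
    · rw [bitAdj_of_gt hlt, List.getD_eq_getElem _ _ hi, G.adj_comm]; exact (h i hi j hlt).2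

theorem IsCoded.exists_of_containsCode {V : Type*} {G : SimpleGraph V} {R P : List ℕ} {f : ℕ → V}
    (hf : IsCoded G R f) {c : ℕ} (hR : R.length ≤ 8)
    (hc : Packs c R) (h : containsCode c R.length P = true) : ∃ g, IsCoded G P g := by
  obtain ⟨l, hl, hlt, hl'⟩ := extendable_spec hR hc (by simp) h
  refine ⟨fun i => f (l.getD i 0), IsCoded.of_lt ?_⟩
  intro i hi j hj
  have hmem : ∀ k < P.length, l.getD k 0 < R.length := by
    intro k hk
    rw [List.getD_eq_getElem _ _ (hl ▸ hk)]
    exact hlt _ (List.getElem_mem _)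
  obtain ⟨h1, h2⟩ := hl' i hi j (by simpa using hj)
  simp only [List.nil_append] at h1 h2
  have hj' := hmem j (hj.trans hi)
  refine ⟨fun h => h1 (hf.1 hj' (hmem i hi) h), ?_⟩
  rw [hf.2 _ hj' _ (hmem i hi), h2]

/-- The new code entry `S` records the neighbours of `v`. It is nonzero because `v` has a neighbour,
which is why `extensionCheck` may skip `S = 0`. -/
theorem IsCoded.concat {V : Type*} {G : SimpleGraph V} {R : List ℕ} {f : ℕ → V}
    (hf : IsCoded G R f) {v : V} (hv : ∀ i < R.length, f i ≠ v) (hadj : ∃ i < R.length, G.Adj (f i) v) :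
    ∃ S < 2 ^ R.length, S ≠ 0 ∧ ∃ g, IsCoded G (R ++ [S]) g := by
  classical
  refine ⟨Nat.ofBits fun i : Fin R.length => decide (G.Adj (f i) v), Nat.ofBits_lt_two_pow _, ?_,
    fun i => if i < R.length then f i else v, IsCoded.of_lt ?_⟩
  · obtain ⟨i, hi, h⟩ := hadj
    intro h0
    have := congrArg (fun n => n.testBit i) h0
    simp [Nat.testBit_ofBits_lt _ _ hi, h] at this
  · intro i hi j hj
    have hi' : i < R.length + 1 := by simpa using hi
    rcases Nat.lt_succ_iff_lt_or_eq.1 hi' with hlt | rfl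
    · have hj' := hj.trans hlt
      simp only [hlt, hj', if_true, List.getElem_append_left]
      refine ⟨fun h => hj.ne (hf.1 hj' hlt h), ?_⟩
      rw [hf.2 _ hj' _ hlt, bitAdj_of_lt hj, List.getD_eq_getElem _ _ hlt]
    · simp [hj, Nat.testBit_ofBits_lt _ _ hj, hv j hj]

/-- A graph code with an integral vector and the coefficients of a quadratic form. -/
structure Obstruction where
  code : List ℕ
  vec : List ℤ
  p : ℤ
  q : ℤ

/-- The quadratic form is not positive on the vector. -/
def Obstruction.Valid (b : Obstruction) : Prop :=
  (∃ i < b.code.length, b.vec.getD i 0 ≠ 0) ∧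
    b.p * ∑ i : Fin b.code.length, b.vec.getD i 0 * b.vec.getD i 0 +
    b.q * ∑ i : Fin b.code.length, ∑ j : Fin b.code.length,
      (if bitAdj b.code i j = true then b.vec.getD i 0 * b.vec.getD j 0 else 0) ≤ 0

instance (b : Obstruction) : Decidable b.Valid := by unfold Obstruction.Valid; infer_instance

theorem Obstruction.Valid.not_isCoded {V : Type*} {G : SimpleGraph V} [DecidableRel G.Adj]
    {b : Obstruction} (hb : b.Valid) (hG : FormPos G b.p b.q) (f : ℕ → V) :
    ¬ IsCoded G b.code f := by
  intro hf
  obtain ⟨⟨i, hi, hne⟩, hle⟩ := hb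
  refine absurd (hG b.code.length (fun i => f i) ?_ (fun i => b.vec.getD i 0) ?_) (not_lt.2 ?_)
  · intro i j hij
    exact Fin.ext (hf.1 i.2 j.2 hij)
  · exact Function.ne_iff.2 ⟨⟨i, hi⟩, hne⟩
  · simp only [hf.2 _ (Fin.is_lt _) _ (Fin.is_lt _)]
    exact hle

/-- The graph with `n` vertices and packed adjacency matrix `c` contains one of the obstructions
or one of the graphs in `L`. -/
def extensionFound (bad : List Obstruction) (L : List (List ℕ)) (n c : ℕ) : Bool :=
  (bad.any fun b => Nat.ble b.code.length n && containsCode c n b.code) ||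
    L.any fun P => containsCode c n P

/-- Every one-vertex extension of a graph in `L` contains one of the obstructions or one of the
graphs in `L'`. The graphs in `L` come with their packed adjacency matrices. -/
def extensionCheck (bad : List Obstruction) (L L' : List (ℕ × List ℕ)) : Bool :=
  L.all fun R => (List.range (2 ^ R.2.length)).all fun S => Nat.beq S 0 ||
    extensionFound bad (L'.map Prod.snd) (R.2.length + 1) (addVertex R.1 R.2.length S)

/-- Induction on the number of vertices, deleting a vertex that is not a cut vertex. Positivity of
the forms passes to induced subgraphs and excludes the obstructions. Codes in `L n` have length `n`,
so the embedding obtained covers all vertices. -/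
theorem exists_isCoded_of_connected {bad : List Obstruction} {L : ℕ → List (ℕ × List ℕ)} {N : ℕ}
    (hbad : ∀ b ∈ bad, b.Valid) (hN8 : N ≤ 8) (hlen : ∀ n ≤ N, ∀ R ∈ L n, R.2.length = n ∧ Packs R.1 R.2)
    (h1 : (0, [0]) ∈ L 1)
    (hstep : ∀ n < N, extensionCheck bad (L n) (L (n + 1)) = true)
    {V : Type*} [Fintype V] (G : SimpleGraph V) [DecidableRel G.Adj] (hG : G.Connected)
    (hN : Fintype.card V ≤ N) (hpos : ∀ b ∈ bad, FormPos G b.p b.q) :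
    ∃ R ∈ L (Fintype.card V), ∃ f, IsCoded G R.2 f := by
  classical
  induction hn : Fintype.card V generalizing V with
  | zero =>
    have := hG.nonempty
    exact absurd hn Fintype.card_ne_zero
  | succ n ih =>
    rcases subsingleton_or_nontrivial V with hV | hV
    · obtain ⟨v⟩ := hG.nonempty
      have : n = 0 := by
        have := Fintype.card_le_one_iff_subsingleton.2 hV
        omega
      subst this
      refine ⟨(0, [0]), h1, fun _ => v, IsCoded.of_lt ?_⟩
      intro i hi j hj
      simp at hi; omega
    · obtain ⟨v, hv⟩ := hG.exists_connected_induce_compl_singleton_of_finite_nontrivial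
      have hcard : Fintype.card ({v}ᶜ : Set V) = n := by
        rw [Fintype.card_compl_set, hn]; simp
      obtain ⟨⟨c, R⟩, hR, f, hf⟩ := ih (G.induce {v}ᶜ) hv (by omega)
        (fun b hb => (hpos b hb).induce G _) hcard
      obtain ⟨hRl, hpack⟩ := hlen n (by omega) _ hR
      change R.length = n at hRl
      have hf' : IsCoded G R (fun i => (f i : V)) :=
        ⟨fun i hi j hj h => hf.1 hi hj (Subtype.ext h), fun i hi j hj => by
          simpa using hf.2 i hi j hj⟩
      -- By counting, the coded vertices are all vertices other than `v`, so they include a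
      -- neighbour of `v`.
      have hsurj : ∀ w : V, w ≠ v → ∃ i < R.length, (f i : V) = w := by
        intro w hw
        have : Function.Bijective (fun i : Fin n => f i) := by
          rw [Fintype.bijective_iff_injective_and_card]
          refine ⟨fun i j hij => Fin.ext (hf.1 (hRl ▸ i.2) (hRl ▸ j.2) hij), by simp [hcard]⟩
        obtain ⟨i, hi⟩ := this.2 ⟨w, hw⟩
        exact ⟨i, hRl ▸ i.2, congrArg Subtype.val hi⟩
      obtain ⟨w, hw⟩ := hG.preconnected.exists_adj_of_nontrivial v
      obtain ⟨S, hS, hS0, g, hg⟩ := hf'.concat (v := v) (fun i _ => (f i).2) (by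
        obtain ⟨i, hi, h⟩ := hsurj w hw.ne'
        exact ⟨i, hi, h ▸ hw.symm⟩)
      have := hstep n (by omega)
      rw [extensionCheck, List.all_eq_true] at this
      have := List.all_eq_true.1 (this (c, R) hR) S (List.mem_range.2 hS)
      simp only [extensionFound, Bool.or_eq_true, List.any_eq_true, Bool.and_eq_true] at this
      have hl : (R ++ [S]).length = R.length + 1 := by simp
      have hl8 : (R ++ [S]).length ≤ 8 := by omega
      have hpack' := hpack.addVertex (show R.length < 8 by omega) hS
      rw [← hl] at this
      rcases this with h | ⟨b, hb, -, h⟩ | ⟨P, hP, h⟩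
      · exact absurd (Nat.eq_of_beq_eq_true h) hS0
      · obtain ⟨g', hg'⟩ := hg.exists_of_containsCode hl8 hpack' h
        exact absurd hg' ((hbad b hb).not_isCoded (hpos b hb) g')
      · obtain ⟨P', hP', rfl⟩ := List.mem_map.1 hP
        obtain ⟨g', hg'⟩ := hg.exists_of_containsCode hl8 hpack' h
        exact ⟨P', hP', g', hg'⟩

end Growth

/-! ### Obstructions and complete lists for the two spectral ranges -/

section Tables

/-- Cycles and extended Dynkin graphs with at most 8 vertices: their largest eigenvalue is `2`. -/
def smithObstructions : List Obstruction :=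
 [⟨[0, 1, 3], [1, 1, 1], 2, -1⟩,
  ⟨[0, 1, 2, 5], [1, 1, 1, 1], 2, -1⟩,
  ⟨[0, 1, 1, 2, 12], [1, 1, 1, 1, 1], 2, -1⟩,
  ⟨[0, 1, 2, 2, 2], [1, 2, 1, 1, 1], 2, -1⟩,
  ⟨[0, 1, 1, 1, 8, 8], [2, 1, 1, 2, 1, 1], 2, -1⟩,
  ⟨[0, 1, 1, 2, 8, 20], [1, 1, 1, 1, 1, 1], 2, -1⟩,
  ⟨[0, 1, 2, 1, 4, 16, 40], [1, 1, 1, 1, 1, 1, 1], 2, -1⟩,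
  ⟨[0, 1, 2, 2, 8, 16, 16], [1, 2, 1, 2, 2, 1, 1], 2, -1⟩,
  ⟨[0, 1, 1, 1, 2, 4, 16, 32], [4, 3, 3, 2, 2, 2, 1, 1], 2, -1⟩,
  ⟨[0, 1, 1, 1, 4, 16, 32, 32], [2, 1, 2, 1, 2, 2, 1, 1], 2, -1⟩,
  ⟨[0, 1, 1, 1, 2, 4, 8], [3, 2, 2, 2, 1, 1, 1], 2, -1⟩,
  ⟨[0, 1, 1, 2, 4, 8, 32, 80], [1, 1, 1, 1, 1, 1, 1, 1], 2, -1⟩]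

/-- The connected graphs on `n ≤ 8` vertices with largest eigenvalue less than `2`, with their
packed adjacency matrices. -/
def smithCodes (n : ℕ) : List (ℕ × List ℕ) :=
 ([[],
  [(0, [0])],
  [(258, [0, 1])],
  [(65798, [0, 1, 1])],
  [(16843022, [0, 1, 1, 1]), (33622278, [0, 1, 1, 2])],
  [(8606781710, [0, 1, 1, 1, 2]), (17214540038, [0, 1, 1, 2, 4])],
  [(4432744547586, [0, 1, 2, 4, 8, 4]), (17738231779598, [0, 1, 1, 1, 2, 16]), (8813844433158, [0, 1, 1, 2, 4, 8])],
  [(1143664231974146, [0, 1, 2, 4, 8, 16, 4]), (9095306230698254, [0, 1, 1, 1, 2, 16, 32]), (4512688349710598, [0, 1, 1, 2, 4, 8, 16])],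
  [(297325708479956226, [0, 1, 2, 4, 8, 16, 32, 4]), (4656810121677050126, [0, 1, 1, 1, 2, 16, 32, 64]), (2310496435051759878, [0, 1, 1, 2, 4, 8, 16, 32])]] : List (List (ℕ × List ℕ))).getD n []

/-- Graphs with an eigenvalue at most `-13/8` or at least `81/25`. -/
def goldenObstructions : List Obstruction :=
 [⟨[0, 0, 0, 7], [-1, -1, -1, 2], 13, 8⟩,
  ⟨[0, 0, 3, 3], [-1, -1, 1, 1], 13, 8⟩,
  ⟨[0, 0, 3, 2, 10], [1, 2, -2, -1, -1], 13, 8⟩,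
  ⟨[0, 0, 2, 5, 14], [-1, 1, -1, 2, -1], 13, 8⟩,
  ⟨[0, 1, 2, 4, 0, 0, 38, 86], [1, 3, 3, 1, 1, 1, 3, 3], 81, -25⟩,
  ⟨[0, 0, 3, 7, 14], [-3, -2, 3, 3, -2], 13, 8⟩,
  ⟨[0, 0, 3, 7, 6, 21], [1, 1, 1, 1, 1, 1], 81, -25⟩,
  ⟨[0, 1, 0, 4, 15, 19], [3, 3, 2, 2, 4, 3], 81, -25⟩,
  ⟨[0, 0, 2, 1, 10], [-1, 2, -1, 2, -2], 13, 8⟩,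
  ⟨[0, 0, 3, 7, 15], [2, 2, -1, -1, -1], 13, 8⟩,
  ⟨[0, 1, 3, 7, 15], [1, 1, 1, 1, 1], 81, -25⟩]

/-- The connected graphs on `n ≤ 8` vertices with all eigenvalues between `-13/8` and `81/25`, with
their packed adjacency matrices. -/
def goldenCodes (n : ℕ) : List (ℕ × List ℕ) :=
 ([[],
  [(0, [0])],
  [(258, [0, 1])],
  [(65798, [0, 1, 1]), (197894, [0, 1, 3])],
  [(33622278, [0, 1, 1, 2]), (50399502, [0, 1, 1, 3]), (118032654, [0, 1, 1, 7]), (118164750, [0, 1, 3, 7])],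
  [(12918528278, [0, 1, 1, 2, 3]), (51842713862, [0, 1, 1, 2, 12]), (64727619862, [0, 1, 1, 2, 15]), (21526284574, [0, 1, 1, 3, 5]), (47563479326, [0, 1, 1, 3, 11])],
  [(16506131921206, [0, 1, 1, 2, 3, 15]), (17742543526166, [0, 1, 1, 2, 3, 16]), (21041078417718, [0, 1, 1, 2, 3, 19])],
  [(5366041978952022, [0, 1, 1, 2, 3, 16, 19])],
  []] : List (List (ℕ × List ℕ))).getD n []

/-- The vectors are positive eigenvectors for the eigenvalue 2, so the form `2|x|² - xᵀAx` vanishes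
on them. The extended `E₈` diagram has nine vertices and is not needed. -/
theorem smithObstructions_valid : ∀ b ∈ smithObstructions, b.Valid := by
  decide +kernel

theorem goldenObstructions_valid : ∀ b ∈ goldenObstructions, b.Valid := by
  decide +kernel

theorem smithCodes_step :
    ∀ n < 8, extensionCheck smithObstructions (smithCodes n) (smithCodes (n + 1)) = true := by
  decide +kernel

theorem goldenCodes_step :
    ∀ n < 8, extensionCheck goldenObstructions (goldenCodes n) (goldenCodes (n + 1)) = true := by
  decide +kernel

end Tables

/-! ### Certificates for being a generalized line graph -/

section Labelling

/-- Labels of the vertices of a generalized line graph in which every cocktail party graph has at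
most one class. -/
abbrev Label (W : Type*) := Sym2 W ⊕ W × Bool

/-- Adjacency of vertices in terms of their labels. -/
def labelAdj {W : Type*} : Label W → Label W → Prop
  | .inl e, .inl f => e ≠ f ∧ ∃ w, w ∈ e ∧ w ∈ f
  | .inl e, .inr p => p.1 ∈ e
  | .inr p, .inl e => p.1 ∈ e
  | .inr _, .inr _ => False

instance {W : Type*} [Fintype W] [DecidableEq W] :
    ∀ x y : Label W, Decidable (labelAdj x y)
  | .inl _, .inl _ => by unfold labelAdj; infer_instance
  | .inl _, .inr _ => by unfold labelAdj; infer_instance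
  | .inr _, .inl _ => by unfold labelAdj; infer_instance
  | .inr _, .inr _ => by unfold labelAdj; infer_instance

/-- The edges of `H` are the edge labels in use, and `a w` is 1 or 0 according to whether the pair
of labels at `w` occurs. With at most one class per cocktail party graph, its two vertices are
non-adjacent. -/
theorem isGeneralizedLineGraph_of_label {V : Type*} {G : SimpleGraph V} {m : ℕ}
    (l : V → Label (Fin m)) (hl : Function.Injective l)
    (hdiag : ∀ v e, l v = .inl e → ¬ e.IsDiag)
    (hcp : ∀ w, .inr (w, false) ∈ Set.range l ↔ .inr (w, true) ∈ Set.range l)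
    (hadj : ∀ u v, G.Adj u v ↔ labelAdj (l u) (l v)) : IsGeneralizedLineGraph G := by
  classical
  let H : SimpleGraph (Fin m) := SimpleGraph.fromEdgeSet {e | .inl e ∈ Set.range l}
  let a : Fin m → ℕ := fun w => if .inr (w, true) ∈ Set.range l then 1 else 0
  have hH : ∀ e, e ∈ H.edgeSet ↔ .inl e ∈ Set.range l := by
    intro e
    rw [SimpleGraph.edgeSet_fromEdgeSet, Set.mem_sdiff]
    refine ⟨fun h => h.1, fun h => ⟨h, ?_⟩⟩
    obtain ⟨v, hv⟩ := h
    exact hdiag v e hv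
  have ha : ∀ w, 0 < a w ↔ .inr (w, true) ∈ Set.range l := by
    intro w
    by_cases h : .inr (w, true) ∈ Set.range l
    · simp only [a, if_pos h]; simp only [h, Nat.one_pos]
    · simp only [a, if_neg h]; simp only [h, lt_irrefl]
  have ha1 : ∀ w, ∀ i : Fin (a w), (i : ℕ) = 0 := by
    intro w i
    have := i.2
    simp only [a] at this
    split_ifs at this <;> omega
  let t : (H.edgeSet ⊕ (Σ w : Fin m, Fin (a w) × Bool)) → Label (Fin m) :=
    Sum.map Subtype.val fun p => (p.1, p.2.2)
  have ht : Function.Injective t := by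
    rintro (e | ⟨w, i, b⟩) (f | ⟨w', j, b'⟩) h
    · simpa [t, Subtype.ext_iff] using h
    · simp [t] at h
    · simp [t] at h
    · simp only [t, Sum.map_inr, Sum.inr.injEq, Prod.mk.injEq] at h
      obtain ⟨rfl, rfl⟩ := h
      have : i = j := Fin.ext (by rw [ha1, ha1])
      rw [this]
  have hrange : Set.range t = Set.range l := by
    ext x
    rcases x with e | ⟨w, b⟩
    · rw [← hH]
      constructor
      · rintro ⟨e' | p, h⟩
        · simp only [t, Sum.map_inl, Sum.inl.injEq] at h
          exact h ▸ e'.2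
        · simp [t] at h
      · exact fun h => ⟨.inl ⟨e, h⟩, rfl⟩
    · have hb : .inr (w, b) ∈ Set.range l ↔ .inr (w, true) ∈ Set.range l := by
        cases b
        · exact hcp w
        · rfl
      rw [hb, ← ha]
      constructor
      · rintro ⟨e' | ⟨w', i, b'⟩, h⟩
        · simp [t] at h
        · simp only [t, Sum.map_inr, Sum.inr.injEq, Prod.mk.injEq] at h
          obtain ⟨rfl, rfl⟩ := h
          exact i.pos
      · exact fun h => ⟨.inr ⟨w, ⟨0, h⟩, b⟩, rfl⟩
  have htadj : ∀ x y, (generalizedLineGraph H a).Adj x y ↔ labelAdj (t x) (t y) := by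
    rintro (e | p) (f | q)
    · change H.lineGraph.Adj e f ↔ _
      rw [SimpleGraph.lineGraph_adj_iff_exists]
      simp [t, labelAdj, Subtype.ext_iff]
    · rfl
    · rfl
    · change (p.1 = q.1 ∧ (p.2.1 : ℕ) ≠ (q.2.1 : ℕ)) ↔ False
      simp [ha1]
  let φ : V ≃ (H.edgeSet ⊕ (Σ w : Fin m, Fin (a w) × Bool)) :=
    (Equiv.ofInjective l hl).trans
      ((Equiv.setCongr hrange.symm).trans (Equiv.ofInjective t ht).symm)
  have hφ : ∀ v, t (φ v) = l v := by
    intro v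
    simp only [φ, Equiv.trans_apply, Equiv.apply_ofInjective_symm]
    rfl
  exact ⟨m, H, a, ⟨⟨φ, by intro u v; rw [htadj, hφ, hφ, hadj]⟩⟩⟩

theorem isGeneralizedLineGraph_top {V : Type*} [Finite V] :
    IsGeneralizedLineGraph (⊤ : SimpleGraph V) := by
  obtain ⟨n, ⟨e⟩⟩ := Finite.exists_equiv_fin V
  -- A complete graph is the line graph of a star with centre 0.
  refine isGeneralizedLineGraph_of_label (m := n + 1) (fun v => .inl s(0, (e v).succ)) ?_ ?_ ?_ ?_
  · intro u v h
    simpa [Fin.succ_ne_zero] using h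
  · rintro v _ ⟨⟩
    simpa using (Fin.succ_ne_zero (e v)).symm
  · intro w
    simp
  · intro u v
    simp only [labelAdj, top_adj]
    refine ⟨fun h => ⟨?_, 0, by simp, by simp⟩, ?_⟩
    · simpa [Fin.succ_ne_zero] using h
    · rintro ⟨h, -⟩ rfl
      exact h rfl

/-- The label is a vertex of a cocktail party graph or an honest edge. -/
def Label.IsProper {W : Type*} : Label W → Prop
  | .inl e => ¬ e.IsDiag
  | .inr _ => True

instance {W : Type*} [DecidableEq W] : ∀ x : Label W, Decidable x.IsProper
  | .inl _ => by unfold Label.IsProper; infer_instance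
  | .inr _ => by unfold Label.IsProper; infer_instance

/-- The vertices of the graph coded by `R` can be labelled by the entries of `l`. -/
def IsLabelling (R : List ℕ) (l : List (Label (Fin 9))) : Prop :=
  l.length = R.length ∧ l.Nodup ∧
    (∀ x ∈ l, x.IsProper) ∧
    (∀ w, .inr (w, false) ∈ l ↔ .inr (w, true) ∈ l) ∧
    ∀ (i : Fin l.length) (j : Fin l.length), labelAdj l[i] l[j] ↔ bitAdj R i j = true

instance (R : List ℕ) (l : List (Label (Fin 9))) : Decidable (IsLabelling R l) := by
  have (x : Label (Fin 9)) : Decidable (x ∈ l) := decidable_of_iff (∃ y ∈ l, x = y) (by simp)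
  unfold IsLabelling
  infer_instance

theorem IsCoded.exists_equiv {V : Type*} [Fintype V] {G : SimpleGraph V} {R : List ℕ} {f : ℕ → V}
    (hf : IsCoded G R f) {n : ℕ} (hn : R.length = n) (hcard : Fintype.card V = n) :
    ∃ e : V ≃ Fin n, ∀ u v, G.Adj u v ↔ bitAdj R (e u) (e v) = true := by
  have : Function.Bijective (fun i : Fin n => f i) := by
    rw [Fintype.bijective_iff_injective_and_card]
    exact ⟨fun i j hij => Fin.ext (hf.1 (hn ▸ i.2) (hn ▸ j.2) hij), by simp [hcard]⟩
  let e := Equiv.ofBijective _ this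
  refine ⟨e.symm, fun u v => ?_⟩
  have h : ∀ w, f (e.symm w) = w := fun w => e.apply_symm_apply w
  rw [← hf.2 _ (hn ▸ (e.symm u).2) _ (hn ▸ (e.symm v).2), h, h]

theorem IsCoded.isGeneralizedLineGraph {V : Type*} [Fintype V] {G : SimpleGraph V} {R : List ℕ}
    {f : ℕ → V} (hf : IsCoded G R f) (hcard : Fintype.card V = R.length)
    {l : List (Label (Fin 9))} (hl : IsLabelling R l) : IsGeneralizedLineGraph G := by
  obtain ⟨h1, h2, h3, h4, h5⟩ := hl
  obtain ⟨e, he⟩ := hf.exists_equiv h1.symm (hcard.trans h1.symm)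
  have hmem : ∀ x, x ∈ Set.range (fun v => l[e v]) ↔ x ∈ l := by
    intro x
    rw [List.mem_iff_getElem]
    constructor
    · rintro ⟨v, rfl⟩
      exact ⟨e v, (e v).2, rfl⟩
    · rintro ⟨i, hi, rfl⟩
      exact ⟨e.symm ⟨i, hi⟩, by simp⟩
  refine isGeneralizedLineGraph_of_label (fun v => l[e v]) ?_ ?_ ?_ ?_
  · intro u v h
    exact e.injective (Fin.ext ((List.Nodup.getElem_inj_iff h2).1 h))
  · intro v x hx
    have := h3 l[e v] (List.getElem_mem _)
    rwa [hx] at this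
  · intro w
    rw [hmem, hmem]
    exact h4 w
  · intro u v
    rw [he, h5]

end Labelling

/-! ### Classification of the connected graphs in the two ranges -/

section Classification

/-- Labels of graphs with `n` vertices. -/
def labelTable (n : ℕ) : List (List (Label (Fin 9))) :=
 ([[],
  [[.inl s(0, 1)]],
  [[.inl s(0, 1), .inl s(0, 2)]],
  [[.inl s(0, 1), .inl s(0, 2), .inl s(1, 3)],
   [.inl s(0, 1), .inl s(0, 2), .inl s(1, 2)]],
  [[.inl s(0, 1), .inl s(0, 2), .inl s(1, 3), .inl s(2, 4)],
   [.inl s(0, 1), .inl s(0, 2), .inl s(1, 3), .inl s(0, 4)],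
   [.inl s(0, 1), .inl s(0, 2), .inl s(1, 3), .inl s(1, 2)],
   [.inl s(0, 1), .inl s(0, 2), .inl s(0, 3), .inl s(0, 4)],
   [.inl s(0, 1), .inl s(1, 2), .inr (0, false), .inr (0, true)]],
  [[.inl s(0, 1), .inl s(0, 2), .inl s(1, 3), .inl s(2, 4), .inl s(0, 5)],
   [.inl s(0, 1), .inl s(0, 2), .inl s(1, 3), .inl s(2, 4), .inl s(3, 4)],
   [.inl s(0, 1), .inl s(0, 2), .inl s(1, 3), .inl s(2, 4), .inl s(1, 2)],
   [.inl s(0, 1), .inl s(0, 2), .inl s(1, 3), .inl s(0, 4), .inl s(1, 5)],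
   [.inl s(0, 1), .inl s(0, 2), .inl s(1, 3), .inl s(0, 4), .inl s(0, 5)],
   [.inl s(0, 1), .inl s(1, 2), .inr (0, false), .inr (0, true), .inl s(2, 3)],
   [.inl s(0, 1), .inl s(0, 2), .inl s(1, 3), .inl s(2, 4), .inl s(3, 5)]],
  [[.inl s(0, 1), .inl s(0, 2), .inl s(1, 3), .inl s(2, 4), .inl s(0, 5), .inl s(1, 2)],
   [.inl s(0, 1), .inl s(0, 2), .inl s(1, 3), .inl s(2, 4), .inl s(0, 5), .inl s(5, 6)],
   [.inl s(0, 1), .inl s(0, 2), .inl s(1, 3), .inl s(2, 4), .inl s(0, 5), .inl s(0, 6)],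
   [.inl s(0, 1), .inl s(1, 2), .inr (0, false), .inr (0, true), .inl s(2, 3), .inl s(3, 4)],
   [.inl s(0, 1), .inl s(0, 2), .inl s(1, 3), .inl s(2, 4), .inl s(3, 5), .inl s(4, 6)]],
  [[.inl s(0, 1), .inl s(0, 2), .inl s(1, 3), .inl s(2, 4), .inl s(0, 5), .inl s(5, 6), .inl s(0, 7)],
   [.inl s(0, 1), .inl s(1, 2), .inr (0, false), .inr (0, true), .inl s(2, 3), .inl s(3, 4), .inl s(4, 5)],
   [.inl s(0, 1), .inl s(0, 2), .inl s(1, 3), .inl s(2, 4), .inl s(3, 5), .inl s(4, 6), .inl s(5, 7)]],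
  [[.inl s(0, 1), .inl s(1, 2), .inr (0, false), .inr (0, true), .inl s(2, 3), .inl s(3, 4), .inl s(4, 5), .inl s(5, 6)],
   [.inl s(0, 1), .inl s(0, 2), .inl s(1, 3), .inl s(2, 4), .inl s(3, 5), .inl s(4, 6), .inl s(5, 7), .inl s(6, 8)]]] : List (List (List (Label (Fin 9))))).getD n []

theorem goldenCodes_isLabelling :
    ∀ n ≤ 8, ∀ R ∈ goldenCodes n, ∃ l ∈ labelTable n, IsLabelling R.2 l := by
  decide +kernel

/-- Paths are line graphs of paths (the one on 8 vertices needs 9 labels), and `D_n` comes from a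
path with one cocktail party class at an end. The remaining codes number the vertices as `dynkinE`
does. -/
theorem smithCodes_isLabelling :
    ∀ n ≤ 8, ∀ R ∈ smithCodes n, (∃ l ∈ labelTable n, IsLabelling R.2 l) ∨
      ((n = 6 ∨ n = 7 ∨ n = 8) ∧
        ∀ i j : Fin n, bitAdj R.2 i j = true ↔ (dynkinE n).Adj i j) := by
  decide +kernel

theorem goldenCodes_packs : ∀ n ≤ 8, ∀ R ∈ goldenCodes n, R.2.length = n ∧ Packs R.1 R.2 := by
  decide +kernel

theorem smithCodes_packs : ∀ n ≤ 8, ∀ R ∈ smithCodes n, R.2.length = n ∧ Packs R.1 R.2 := by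
  decide +kernel

theorem isGeneralizedLineGraph_of_formPos {V : Type*} [Fintype V] (G : SimpleGraph V)
    [DecidableRel G.Adj] (hG : G.Connected) (hcard : Fintype.card V ≤ 8) (h1 : FormPos G 13 8)
    (h2 : FormPos G 81 (-25)) : IsGeneralizedLineGraph G := by
  have hpos : ∀ b ∈ goldenObstructions, FormPos G b.p b.q := by
    have h : ∀ b ∈ goldenObstructions, (b.p = 13 ∧ b.q = 8) ∨ (b.p = 81 ∧ b.q = -25) := by
      decide +kernel
    intro b hb
    rcases h b hb with ⟨hp, hq⟩ | ⟨hp, hq⟩ <;> rwa [hp, hq]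
  obtain ⟨R, hR, f, hf⟩ := exists_isCoded_of_connected goldenObstructions_valid le_rfl
    goldenCodes_packs (by decide +kernel) goldenCodes_step G hG hcard hpos
  obtain ⟨l, -, hl⟩ := goldenCodes_isLabelling _ hcard R hR
  exact hf.isGeneralizedLineGraph (goldenCodes_packs _ hcard R hR).1.symm hl

theorem isGeneralizedLineGraph_or_dynkinE {V : Type*} [Fintype V] (G : SimpleGraph V)
    [DecidableRel G.Adj] (hG : G.Connected) (hcard : Fintype.card V ≤ 8)
    (h : FormPos G 2 (-1)) : IsGeneralizedLineGraph G ∨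
      Nonempty (G ≃g dynkinE 6) ∨ Nonempty (G ≃g dynkinE 7) ∨ Nonempty (G ≃g dynkinE 8) := by
  have hpos : ∀ b ∈ smithObstructions, FormPos G b.p b.q := by
    have h' : ∀ b ∈ smithObstructions, b.p = 2 ∧ b.q = -1 := by
      decide +kernel
    intro b hb
    rwa [(h' b hb).1, (h' b hb).2]
  obtain ⟨R, hR, f, hf⟩ := exists_isCoded_of_connected smithObstructions_valid le_rfl
    smithCodes_packs (by decide +kernel) smithCodes_step G hG hcard hpos
  have hlen := (smithCodes_packs _ hcard R hR).1
  rcases smithCodes_isLabelling _ hcard R hR with ⟨l, -, hl⟩ | ⟨hn, hadj⟩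
  · exact .inl (hf.isGeneralizedLineGraph hlen.symm hl)
  · obtain ⟨e, he⟩ := hf.exists_equiv hlen rfl
    have hiso : Nonempty (G ≃g dynkinE (Fintype.card V)) :=
      ⟨⟨e, fun {u v} => by rw [he, hadj]⟩⟩
    rcases hn with hn | hn | hn <;> rw [hn] at hiso
    · exact .inr (.inl hiso)
    · exact .inr (.inr (.inl hiso))
    · exact .inr (.inr (.inr hiso))

end Classification

/-! ### Arithmetic of the conjugates of the smallest eigenvalue -/

section Conjugates

open Polynomial

theorem abs_auxiliary_lt_one {x : ℝ} (h1 : -2 < x) (h2 : x < 1) :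
    |x * (x + 1) * (x + 2) * (x - 1) * (x ^ 2 + x - 1)| < 1 := by
  -- In terms of `z` the product is the cubic `z³ - z`, with `z` in `[-5/4, 1)`.
  set z := x ^ 2 + x - 1 with hz
  have e : x * (x + 1) * (x + 2) * (x - 1) * z = z * (z ^ 2 - 1) := by rw [hz]; ring
  have hz1 : z < 1 := by rw [hz]; nlinarith
  have hz2 : -(5 / 4) ≤ z := by rw [hz]; nlinarith [sq_nonneg (x + 1 / 2)]
  rw [e, abs_lt]
  constructor
  · nlinarith [sq_nonneg (z - 1 / 2), sq_nonneg (z + 1 / 2), mul_nonneg (sub_nonneg.2 hz2) (sq_nonneg (z - 1 / 2))]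
  · nlinarith [sq_nonneg (z + 1 / 2), mul_nonneg (sub_nonneg.2 hz1.le) (sq_nonneg (z + 1 / 2))]

/-- An algebraic integer all of whose conjugates have absolute value less than `1` is zero. -/
theorem eq_zero_of_forall_norm_lt_one {K : Type*} [Field K] [Algebra ℚ K] [FiniteDimensional ℚ K]
    {β : K} (hβ : IsIntegral ℤ β) (h : ∀ σ : K →ₐ[ℚ] ℂ, ‖σ β‖ < 1) : β = 0 := by
  classical
  -- The norm is a rational integer and the product of all conjugates, so it has absolute value less
  -- than 1.
  have h1 : IsIntegral ℤ (Algebra.norm ℚ β) := Algebra.isIntegral_norm ℚ hβ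
  obtain ⟨m, hm⟩ := IsIntegrallyClosed.isIntegral_iff.1 h1
  have h2 := Algebra.norm_eq_prod_embeddings ℚ ℂ β
  have h3 : ‖∏ σ : K →ₐ[ℚ] ℂ, σ β‖ < 1 := by
    rw [norm_prod]
    have : Nonempty (K →ₐ[ℚ] ℂ) := ⟨IsAlgClosed.lift⟩
    obtain ⟨σ⟩ := this
    rw [← Finset.mul_prod_erase _ _ (Finset.mem_univ σ)]
    refine mul_lt_one_of_nonneg_of_lt_one_left (norm_nonneg _) (h σ) ?_
    exact Finset.prod_le_one (fun _ _ => norm_nonneg _) fun τ _ => (h τ).le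
  rw [← h2, ← hm] at h3
  have h4 : |(m : ℝ)| < 1 := by simpa using h3
  have h5 : m = 0 := by
    rw [← Int.cast_abs] at h4
    exact Int.abs_lt_one_iff.1 (by exact_mod_cast h4)
  rw [h5, map_zero] at hm
  exact (Algebra.norm_eq_zero_iff).1 hm.symm

/-- An embedding of `ℚ(θ)` sends both `θ` and `-kθ` to roots of `P`, which confines every conjugate
of `θ` to `(-2, 1)`; the auxiliary polynomial then vanishes at `θ`. -/
theorem sq_add_self_sub_one_eq_zero {P : ℤ[X]} (hP : P.Monic) {θ : ℝ} {k : ℕ} (hk : 2 ≤ k)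
    (hreal : ∀ z : ℂ, aeval z P = 0 → ∃ x : ℝ, z = x ∧ θ ≤ x) (hθ : aeval θ P = 0)
    (hkθ : aeval (-k * θ) P = 0) (h2 : -2 < θ) (h1 : θ < -1) : θ ^ 2 + θ - 1 = 0 := by
  have hint : IsIntegral ℤ θ := ⟨P, hP, by simpa [aeval_def] using hθ⟩
  have hintQ : IsIntegral ℚ θ := hint.tower_top
  let K := IntermediateField.adjoin ℚ {θ}
  have : FiniteDimensional ℚ K := IntermediateField.adjoin.finiteDimensional hintQ
  let α : K := IntermediateField.AdjoinSimple.gen ℚ θ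
  have hα : (algebraMap K ℝ) α = θ := IntermediateField.AdjoinSimple.algebraMap_gen ℚ θ
  have hinj : Function.Injective (algebraMap K ℝ) := (algebraMap K ℝ).injective
  have hαP : aeval α P = 0 := by
    apply hinj
    rw [← aeval_algebraMap_apply, hα, hθ, map_zero]
  have hkαP : aeval (-k * α) P = 0 := by
    apply hinj
    rw [← aeval_algebraMap_apply, map_zero, map_mul, hα]
    simpa using hkθ
  have hαint : IsIntegral ℤ α := ⟨P, hP, by simpa [aeval_def] using hαP⟩
  have hbound : ∀ σ : K →ₐ[ℚ] ℂ, ∃ x : ℝ, σ α = x ∧ -2 < x ∧ x < 1 := by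
    intro σ
    have e : ∀ y : K, aeval (σ y) P = σ (aeval y P) := fun y =>
      aeval_algHom_apply (σ.restrictScalars ℤ) y P
    obtain ⟨x, hx, hθx⟩ := hreal (σ α) (by rw [e, hαP, map_zero])
    obtain ⟨y, hy, hθy⟩ := hreal (σ (-k * α)) (by rw [e, hkαP, map_zero])
    have hyx : y = -k * x := by
      rw [map_mul, hx] at hy
      have : ((-k * x : ℝ) : ℂ) = y := by rw [← hy]; simp
      exact_mod_cast this.symm
    refine ⟨x, hx, h2.trans_le hθx, ?_⟩
    have hk' : (2 : ℝ) ≤ k := by exact_mod_cast hk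
    -- If `x ≥ 1`, then `-kx ≤ -2 < θ`, although `-kx` is a root of `P`.
    by_contra hx1
    nlinarith [not_lt.1 hx1]
  have hβ : α * (α + 1) * (α + 2) * (α - 1) * (α ^ 2 + α - 1) = 0 := by
    apply eq_zero_of_forall_norm_lt_one
    · have hone : IsIntegral ℤ (1 : K) := isIntegral_one
      have htwo : IsIntegral ℤ (2 : K) := by
        rw [← one_add_one_eq_two]; exact hone.add hone
      exact (((hαint.mul (hαint.add hone)).mul (hαint.add htwo)).mul (hαint.sub hone)).mul
        (((hαint.pow 2).add hαint).sub hone)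
    · intro σ
      obtain ⟨x, hx, hx1, hx2⟩ := hbound σ
      have : σ (α * (α + 1) * (α + 2) * (α - 1) * (α ^ 2 + α - 1)) =
          ((x * (x + 1) * (x + 2) * (x - 1) * (x ^ 2 + x - 1) : ℝ) : ℂ) := by
        simp only [map_mul, map_add, map_sub, map_pow, hx, map_one, map_ofNat]
        push_cast
        ring
      rw [this, Complex.norm_real, Real.norm_eq_abs]
      exact abs_auxiliary_lt_one hx1 hx2
  have hθβ := congrArg (algebraMap K ℝ) hβ
  simp only [map_mul, map_add, map_sub, map_pow, hα, map_one, map_ofNat, map_zero] at hθβ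
  have h3 : θ * (θ + 1) * (θ + 2) * (θ - 1) ≠ 0 := by
    refine mul_ne_zero (mul_ne_zero (mul_ne_zero ?_ ?_) ?_) ?_ <;> intro h <;> linarith
  exact (mul_eq_zero.1 hθβ).resolve_left h3

/-- The remainder of `r` modulo `X² + X - 1` is linear with integer coefficients and vanishes at an
irrational number, so it is zero. -/
theorem aeval_goldenConj_eq_zero {r : ℤ[X]} (h : aeval (-Real.goldenRatio) r = 0) :
    aeval (-Real.goldenConj) r = 0 := by
  have hQ : (X ^ 2 + X - 1 : ℤ[X]).Monic := by monicity!
  have hdeg : (X ^ 2 + X - 1 : ℤ[X]).natDegree = 2 := by compute_degree!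
  have hmod := modByMonic_add_div r (X ^ 2 + X - 1 : ℤ[X])
  have hlt : (r %ₘ (X ^ 2 + X - 1 : ℤ[X])).natDegree ≤ 1 := by
    have := natDegree_modByMonic_lt r hQ (by
      intro h; rw [h] at hdeg; simp at hdeg)
    omega
  obtain ⟨a, b, hab⟩ := exists_eq_X_add_C_of_natDegree_le_one hlt
  rw [hab] at hmod
  have h1 := congrArg (aeval (-Real.goldenRatio)) hmod
  have h2 := congrArg (aeval (-Real.goldenConj)) hmod
  have e1 : (-Real.goldenRatio) ^ 2 + (-Real.goldenRatio) - 1 = 0 := by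
    rw [neg_sq, Real.goldenRatio_sq]; ring
  have e2 : (-Real.goldenConj) ^ 2 + (-Real.goldenConj) - 1 = 0 := by
    rw [neg_sq, Real.goldenConj_sq]; ring
  simp only [map_add, map_mul, map_sub, map_pow, map_one, aeval_X, e1, e2, zero_mul,
    add_zero, h, eq_intCast, map_intCast] at h1 h2
  have ha : a = 0 := by
    by_contra ha
    have ha' : (a : ℝ) ≠ 0 := by exact_mod_cast ha
    refine Real.goldenRatio_irrational ⟨(b : ℚ) / a, ?_⟩
    push_cast
    rw [div_eq_iff ha']
    linarith
  subst ha
  rw [← h2]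
  simpa using h1

theorem golden_of_scaled_conjugates {P : ℤ[X]} (hP : P.Monic) {θ : ℝ} {k : ℕ} (hk : 2 ≤ k)
    (hreal : ∀ z : ℂ, aeval z P = 0 → ∃ x : ℝ, z = x ∧ θ ≤ x) (hθ : aeval θ P = 0)
    (hkθ : aeval (-k * θ) P = 0) (h2 : -2 < θ) (h1 : θ < -1) :
    θ = -Real.goldenRatio ∧ k = 2 := by
  have hquad := sq_add_self_sub_one_eq_zero hP hk hreal hθ hkθ h2 h1
  have hφ : θ = -Real.goldenRatio := by
    have e : (θ + Real.goldenRatio) * (θ + 1 - Real.goldenRatio) = 0 := by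
      have := Real.goldenRatio_sq
      linear_combination hquad - this
    rcases mul_eq_zero.1 e with h | h
    · linarith
    · linarith [Real.one_lt_goldenRatio]
  refine ⟨hφ, le_antisymm ?_ hk⟩
  have hcomp : ∀ x : ℝ, aeval x (P.comp (C (-(k : ℤ)) * X)) = aeval (-k * x) P := by
    intro x
    rw [aeval_comp]
    simp
  -- Conjugating in `P(-kX)` makes `-k/φ` a root of `P`; it must be at least `-φ`, so `k ≤ φ² < 3`.
  have hconj := aeval_goldenConj_eq_zero (r := P.comp (C (-(k : ℤ)) * X)) (by
    rw [hcomp, ← hφ, hkθ])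
  rw [hcomp] at hconj
  obtain ⟨x, hx, hle⟩ := hreal ((-k * -Real.goldenConj : ℝ) : ℂ) (by
    have := congrArg (algebraMap ℝ ℂ) hconj
    rwa [← aeval_algebraMap_apply, map_zero] at this)
  have hx' : -k * -Real.goldenConj = x := by exact_mod_cast hx
  rw [← hx', hφ] at hle
  by_contra hk2
  have hk3 : (3 : ℝ) ≤ k := by exact_mod_cast (not_le.1 hk2)
  have h3 := Real.goldenRatio_add_goldenConj
  have h4 := Real.goldenConj_neg
  have h5 := Real.goldenRatio_sq
  have h6 := Real.one_lt_goldenRatio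
  have h7 : 3 / 2 < Real.goldenRatio := by nlinarith
  nlinarith

end Conjugates

/-! ### The Dynkin graphs `E₆, E₇, E₈` are exceptional -/

section ExceptionalDynkin

/-- In a generalized line graph, two of any three independent neighbours of a vertex have the same
neighbours. -/
theorem IsGeneralizedLineGraph.exists_twins {V : Type*} {G : SimpleGraph V}
    (hG : IsGeneralizedLineGraph G) {c : V} (u : Fin 3 → V) (hu : Function.Injective u)
    (hc : ∀ i, G.Adj c (u i)) (hind : ∀ i j, ¬ G.Adj (u i) (u j)) :
    ∃ i j, i < j ∧ ∀ w, G.Adj w (u i) ↔ G.Adj w (u j) := by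
  obtain ⟨n, H, a, ⟨φ⟩⟩ := hG
  have twins : ∀ (x y : Fin 3), x ≠ y → (∃ w : Fin n,
      (∀ z : Fin 3, z = x ∨ z = y → (∃ e : H.edgeSet, φ (u z) = .inl e ∧ w ∈ (e : Sym2 (Fin n))) ∨
        -- Two non-adjacent vertices attached to the same vertex `w` of `H` cannot involve an edge
        -- of `H`, so they form one class of the cocktail party graph at `w`.
        ∃ p, φ (u z) = .inr p ∧ p.1 = w)) → ∀ v, G.Adj v (u x) ↔ G.Adj v (u y) := by
    rintro x y hxy ⟨w, hw⟩ v
    have hne : φ (u x) ≠ φ (u y) := fun h => hxy (hu (φ.injective h))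
    have hna : ¬ (generalizedLineGraph H a).Adj (φ (u x)) (φ (u y)) := by
      rw [φ.map_adj_iff]; exact hind x y
    rcases hw x (.inl rfl) with ⟨e, he, hwe⟩ | ⟨p, hp, hpw⟩ <;>
      rcases hw y (.inr rfl) with ⟨f, hf, hwf⟩ | ⟨q, hq, hqw⟩
    · rw [he, hf] at hne hna
      exact absurd (lineGraph_adj_iff_exists.2 ⟨fun h => hne (congrArg _ h), w, hwe, hwf⟩) hna
    · rw [he, hq] at hna
      exact absurd (show q.1 ∈ (e : Sym2 (Fin n)) from hqw ▸ hwe) hna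
    · rw [hp, hf] at hna
      exact absurd (show p.1 ∈ (f : Sym2 (Fin n)) from hpw ▸ hwf) hna
    · rw [hp, hq] at hna
      have hcls : (p.2.1 : ℕ) = q.2.1 := by
        by_contra h
        exact hna ⟨hpw.trans hqw.symm, h⟩
      rw [← φ.map_adj_iff, ← φ.map_adj_iff (v := v) (w := u y), hp, hq]
      rcases φ v with e | r
      · change p.1 ∈ (e : Sym2 (Fin n)) ↔ q.1 ∈ (e : Sym2 (Fin n))
        rw [hpw, hqw]
      · change (r.1 = p.1 ∧ (r.2.1 : ℕ) ≠ (p.2.1 : ℕ)) ↔ (r.1 = q.1 ∧ (r.2.1 : ℕ) ≠ (q.2.1 : ℕ))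
        rw [hcls, hpw.trans hqw.symm]
  have hc' : ∀ i, (generalizedLineGraph H a).Adj (φ c) (φ (u i)) := fun i => by
    rw [φ.map_adj_iff]; exact hc i
  -- Neighbours of an edge are attached to one of its two ends, and neighbours of a cocktail party
  -- vertex to its base vertex. Of three neighbours, two share the attachment.
  have hatt : ∃ w₁ w₂ : Fin n, ∀ z, ∃ w, (w = w₁ ∨ w = w₂) ∧
      ((∃ e : H.edgeSet, φ (u z) = .inl e ∧ w ∈ (e : Sym2 (Fin n))) ∨
        ∃ p, φ (u z) = .inr p ∧ p.1 = w) := by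
    rcases hφc : φ c with e | p
    · obtain ⟨⟨w₁, w₂⟩, hw⟩ := Sym2.mk_surjective (e : Sym2 (Fin n))
      have hmem : ∀ w, w ∈ (e : Sym2 (Fin n)) ↔ w = w₁ ∨ w = w₂ := fun w => by
        rw [← hw]; exact Sym2.mem_iff
      refine ⟨w₁, w₂, fun z => ?_⟩
      have hz := hc' z
      rw [hφc] at hz
      rcases hφz : φ (u z) with f | q
      · rw [hφz] at hz
        obtain ⟨-, w, hwe, hwf⟩ := lineGraph_adj_iff_exists.1 hz
        exact ⟨w, (hmem w).1 hwe, .inl ⟨f, rfl, hwf⟩⟩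
      · rw [hφz] at hz
        exact ⟨q.1, (hmem q.1).1 hz, .inr ⟨q, rfl, rfl⟩⟩
    · refine ⟨p.1, p.1, fun z => ⟨p.1, .inl rfl, ?_⟩⟩
      have hz := hc' z
      rw [hφc] at hz
      rcases hφz : φ (u z) with f | q
      · rw [hφz] at hz
        exact .inl ⟨f, rfl, hz⟩
      · rw [hφz] at hz
        exact .inr ⟨q, rfl, hz.1.symm⟩
  obtain ⟨w₁, w₂, hatt⟩ := hatt
  choose w hw hatt using hatt
  have hpig : ∃ i j : Fin 3, i < j ∧ w i = w j := by
    rcases hw 0 with h0 | h0 <;> rcases hw 1 with h1 | h1 <;> rcases hw 2 with h2 | h2 <;>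
      first
      | exact ⟨0, 1, by decide, h0.trans h1.symm⟩
      | exact ⟨0, 2, by decide, h0.trans h2.symm⟩
      | exact ⟨1, 2, by decide, h1.trans h2.symm⟩
  obtain ⟨i, j, hij, hwij⟩ := hpig
  refine ⟨i, j, hij, twins i j hij.ne ⟨w i, ?_⟩⟩
  rintro z (rfl | rfl)
  · exact hatt _
  · rw [hwij]; exact hatt _

theorem connected_of_forall_exists_lt {n : ℕ} [NeZero n] (G : SimpleGraph (Fin n))
    (h : ∀ i : Fin n, i ≠ 0 → ∃ j < i, G.Adj i j) : G.Connected := by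
  have key : ∀ i : Fin n, G.Reachable i 0 := by
    intro i
    induction i using WellFoundedLT.induction with
    | ind i ih =>
      by_cases hi : i = 0
      · rw [hi]
      · obtain ⟨j, hj, hadj⟩ := h i hi
        exact hadj.reachable.trans (ih j hj)
  have : Nonempty (Fin n) := ⟨0⟩
  exact ⟨fun i j => (key i).trans (key j).symm⟩

/-- The roots that represent the path of `dynkinE n`. -/
def pathRoot (i : ℕ) : Fin 8 → ℤ := fun k =>
  if (k : ℕ) = i then 2 else if (k : ℕ) = i + 1 then (if i = 6 then -2 else 2) else 0

/-- An `E₈`-representation of `dynkinE n`. -/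
def dynkinRoot (n : ℕ) (i : Fin n) : Fin 8 → ℤ :=
  if (i : ℕ) + 1 = n then ![1, -1, 1, 1, -1, 1, -1, -1] else pathRoot i

theorem pathRoot_mem {i : ℕ} (hi : i < 7) : pathRoot i ∈ rootsE8 := by
  refine .inl ⟨⟨i, by omega⟩, ⟨i + 1, by omega⟩, ?_, ?_, ?_, ?_⟩
  · simp [Fin.ext_iff]
  · simp [pathRoot]
  · by_cases h : i = 6 <;> simp [pathRoot, h]
  · intro k h1 h2
    have h1' : (k : ℕ) ≠ i := fun h => h1 (Fin.ext h)
    have h2' : (k : ℕ) ≠ i + 1 := fun h => h2 (Fin.ext h)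
    simp [pathRoot, h1', h2']

theorem dynkinRoot_mem {n : ℕ} (hn : n ≤ 8) (i : Fin n) : dynkinRoot n i ∈ rootsE8 := by
  unfold dynkinRoot
  split_ifs with h
  · exact .inr (by decide)
  · exact pathRoot_mem (by omega)

/-- Consecutive roots `2eᵢ + 2eᵢ₊₁` have inner product 4, and the signs of the extra root make it
orthogonal to all path roots but the one at 2. With an even number of `+1` this requires the sign
change in the path root at 6. -/
theorem dynkinE_isE8Representable {n : ℕ} (hn : n = 6 ∨ n = 7 ∨ n = 8) :
    IsE8Representable (dynkinE n) := by
  have h : ∀ u v : Fin n, dynkinRoot n u ⬝ᵥ dynkinRoot n v =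
      if u = v then 8 else if (dynkinE n).Adj u v then 4 else 0 := by
    rcases hn with rfl | rfl | rfl <;> decide +kernel
  refine ⟨dynkinRoot n, fun u v huv => ?_, dynkinRoot_mem (by omega), fun u v huv => ?_,
    fun u v hne huv => ?_⟩
  · by_contra hne
    have h1 := h u v
    rw [huv, h v v, if_pos rfl, if_neg hne] at h1
    split_ifs at h1 <;> omega
  · rw [h, if_neg huv.ne, if_pos huv]
  · rw [h, if_neg hne, if_neg huv]

theorem dynkinE_connected {n : ℕ} (hn : n = 6 ∨ n = 7 ∨ n = 8) : (dynkinE n).Connected := by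
  rcases hn with rfl | rfl | rfl <;> refine connected_of_forall_exists_lt _ ?_ <;> decide +kernel

theorem dynkinE_isBipartite {n : ℕ} (hn : n = 6 ∨ n = 7 ∨ n = 8) : (dynkinE n).IsBipartite := by
  refine ⟨Coloring.mk (fun i : Fin n =>
    if (i : ℕ) + 1 = n then (1 : Fin 2) else if (i : ℕ) % 2 = 0 then 0 else 1) ?_⟩
  rcases hn with rfl | rfl | rfl <;> decide +kernel

theorem dynkinE_not_isGeneralizedLineGraph {n : ℕ} (hn : n = 6 ∨ n = 7 ∨ n = 8) :
    ¬ IsGeneralizedLineGraph (dynkinE n) := by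
  intro hG
  have key : ∀ (c : Fin n) (u : Fin 3 → Fin n), Function.Injective u →
      (∀ i, (dynkinE n).Adj c (u i)) → (∀ i j, ¬ (dynkinE n).Adj (u i) (u j)) →
      (∀ i j, i < j → ∃ w, ¬ ((dynkinE n).Adj w (u i) ↔ (dynkinE n).Adj w (u j))) → False := by
    intro c u h1 h2 h3 h4
    obtain ⟨i, j, hij, h⟩ := hG.exists_twins u h1 h2 h3
    obtain ⟨w, hw⟩ := h4 i j hij
    exact hw (h w)
  rcases hn with rfl | rfl | rfl
  · exact key 2 ![1, 3, 5] (by decide) (by decide +kernel) (by decide +kernel) (by decide +kernel)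
  · exact key 2 ![1, 3, 6] (by decide) (by decide +kernel) (by decide +kernel) (by decide +kernel)
  · exact key 2 ![1, 3, 7] (by decide) (by decide +kernel) (by decide +kernel) (by decide +kernel)

theorem dynkinE_isExceptional {n : ℕ} (hn : n = 6 ∨ n = 7 ∨ n = 8) :
    IsExceptional (dynkinE n) :=
  ⟨dynkinE_connected hn, dynkinE_isE8Representable hn, dynkinE_not_isGeneralizedLineGraph hn⟩

end ExceptionalDynkin

/-! ### Positive definiteness, the bound on the order and the Hoffman bound -/

section Exceptional

/-- Half of `xᵀ(A + 2I)x` is a sum of squares, completed along each arm from its leaf towards the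
branch vertex 2. An arm with `r` vertices takes `r/(2(r+1))` from the coefficient of `(x 2)²`; here
`1 - 1/3 - 1/3 - 1/4 = 1/12` remains. For `E₇` and `E₈` the remainders are `1/24` and `1/60`. -/
theorem dynkinE_six_form_pos (x : Fin 6 → ℝ)
    (h : x ⬝ᵥ ((dynkinE 6).adjMatrix ℝ) *ᵥ x ≤ -2 * (x ⬝ᵥ x)) : x = 0 := by
  rw [dotProduct_mulVec_adjMatrix, dotProduct] at h
  simp +decide [Fin.sum_univ_six] at h
  have n0 := sq_nonneg (x 0 + 1 / 2 * x 1)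
  have n1 := sq_nonneg (x 1 + 2 / 3 * x 2)
  have n2 := sq_nonneg (x 4 + 1 / 2 * x 3)
  have n3 := sq_nonneg (x 3 + 2 / 3 * x 2)
  have n4 := sq_nonneg (x 5 + 1 / 2 * x 2)
  have n5 := sq_nonneg (x 2)
  have h0 : x 0 + 1 / 2 * x 1 = 0 := pow_eq_zero_iff two_ne_zero |>.1 (le_antisymm (by linarith) n0)
  have h1 : x 1 + 2 / 3 * x 2 = 0 := pow_eq_zero_iff two_ne_zero |>.1 (le_antisymm (by linarith) n1)
  have h2 : x 4 + 1 / 2 * x 3 = 0 := pow_eq_zero_iff two_ne_zero |>.1 (le_antisymm (by linarith) n2)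
  have h3 : x 3 + 2 / 3 * x 2 = 0 := pow_eq_zero_iff two_ne_zero |>.1 (le_antisymm (by linarith) n3)
  have h4 : x 5 + 1 / 2 * x 2 = 0 := pow_eq_zero_iff two_ne_zero |>.1 (le_antisymm (by linarith) n4)
  have h5 : x 2 = 0 := pow_eq_zero_iff two_ne_zero |>.1 (le_antisymm (by linarith) n5)
  ext i
  fin_cases i <;> simp <;> linarith

theorem dynkinE_seven_form_pos (x : Fin 7 → ℝ)
    (h : x ⬝ᵥ ((dynkinE 7).adjMatrix ℝ) *ᵥ x ≤ -2 * (x ⬝ᵥ x)) : x = 0 := by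
  rw [dotProduct_mulVec_adjMatrix, dotProduct] at h
  simp +decide [Fin.sum_univ_seven] at h
  have n0 := sq_nonneg (x 0 + 1 / 2 * x 1)
  have n1 := sq_nonneg (x 1 + 2 / 3 * x 2)
  have n2 := sq_nonneg (x 5 + 1 / 2 * x 4)
  have n3 := sq_nonneg (x 4 + 2 / 3 * x 3)
  have n4 := sq_nonneg (x 3 + 3 / 4 * x 2)
  have n5 := sq_nonneg (x 6 + 1 / 2 * x 2)
  have n6 := sq_nonneg (x 2)
  have h0 : x 0 + 1 / 2 * x 1 = 0 := pow_eq_zero_iff two_ne_zero |>.1 (le_antisymm (by linarith) n0)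
  have h1 : x 1 + 2 / 3 * x 2 = 0 := pow_eq_zero_iff two_ne_zero |>.1 (le_antisymm (by linarith) n1)
  have h2 : x 5 + 1 / 2 * x 4 = 0 := pow_eq_zero_iff two_ne_zero |>.1 (le_antisymm (by linarith) n2)
  have h3 : x 4 + 2 / 3 * x 3 = 0 := pow_eq_zero_iff two_ne_zero |>.1 (le_antisymm (by linarith) n3)
  have h4 : x 3 + 3 / 4 * x 2 = 0 := pow_eq_zero_iff two_ne_zero |>.1 (le_antisymm (by linarith) n4)
  have h5 : x 6 + 1 / 2 * x 2 = 0 := pow_eq_zero_iff two_ne_zero |>.1 (le_antisymm (by linarith) n5)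
  have h6 : x 2 = 0 := pow_eq_zero_iff two_ne_zero |>.1 (le_antisymm (by linarith) n6)
  ext i
  fin_cases i <;> simp <;> linarith

theorem dynkinE_eight_form_pos (x : Fin 8 → ℝ)
    (h : x ⬝ᵥ ((dynkinE 8).adjMatrix ℝ) *ᵥ x ≤ -2 * (x ⬝ᵥ x)) : x = 0 := by
  rw [dotProduct_mulVec_adjMatrix, dotProduct] at h
  simp +decide [Fin.sum_univ_eight] at h
  have n0 := sq_nonneg (x 0 + 1 / 2 * x 1)
  have n1 := sq_nonneg (x 1 + 2 / 3 * x 2)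
  have n2 := sq_nonneg (x 6 + 1 / 2 * x 5)
  have n3 := sq_nonneg (x 5 + 2 / 3 * x 4)
  have n4 := sq_nonneg (x 4 + 3 / 4 * x 3)
  have n5 := sq_nonneg (x 3 + 4 / 5 * x 2)
  have n6 := sq_nonneg (x 7 + 1 / 2 * x 2)
  have n7 := sq_nonneg (x 2)
  have h0 : x 0 + 1 / 2 * x 1 = 0 := pow_eq_zero_iff two_ne_zero |>.1 (le_antisymm (by linarith) n0)
  have h1 : x 1 + 2 / 3 * x 2 = 0 := pow_eq_zero_iff two_ne_zero |>.1 (le_antisymm (by linarith) n1)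
  have h2 : x 6 + 1 / 2 * x 5 = 0 := pow_eq_zero_iff two_ne_zero |>.1 (le_antisymm (by linarith) n2)
  have h3 : x 5 + 2 / 3 * x 4 = 0 := pow_eq_zero_iff two_ne_zero |>.1 (le_antisymm (by linarith) n3)
  have h4 : x 4 + 3 / 4 * x 3 = 0 := pow_eq_zero_iff two_ne_zero |>.1 (le_antisymm (by linarith) n4)
  have h5 : x 3 + 4 / 5 * x 2 = 0 := pow_eq_zero_iff two_ne_zero |>.1 (le_antisymm (by linarith) n5)
  have h6 : x 7 + 1 / 2 * x 2 = 0 := pow_eq_zero_iff two_ne_zero |>.1 (le_antisymm (by linarith) n6)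
  have h7 : x 2 = 0 := pow_eq_zero_iff two_ne_zero |>.1 (le_antisymm (by linarith) n7)
  ext i
  fin_cases i <;> simp <;> linarith

theorem dynkinE_form_pos {n : ℕ} (hn : n = 6 ∨ n = 7 ∨ n = 8) (x : Fin n → ℝ) (hx : x ≠ 0) :
    -2 * (x ⬝ᵥ x) < x ⬝ᵥ ((dynkinE n).adjMatrix ℝ) *ᵥ x := by
  by_contra hle
  apply hx
  rcases hn with rfl | rfl | rfl
  · exact dynkinE_six_form_pos x (not_lt.1 hle)
  · exact dynkinE_seven_form_pos x (not_lt.1 hle)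
  · exact dynkinE_eight_form_pos x (not_lt.1 hle)

theorem dotProduct_self_of_mem_rootsE8 {x : Fin 8 → ℤ} (hx : x ∈ rootsE8) : x ⬝ᵥ x = 8 := by
  rcases hx with ⟨i, j, hij, hi, hj, h⟩ | ⟨h, -⟩
  · rw [dotProduct, Finset.sum_eq_add i j hij (fun k _ hk => by rw [h k hk.1 hk.2, mul_zero])
      (by simp) (by simp)]
    rcases hi with hi | hi <;> rcases hj with hj | hj <;> rw [hi, hj] <;> norm_num
  · have : ∀ k ∈ Finset.univ, x k * x k = 1 := fun k _ => by
      rcases h k with hk | hk <;> rw [hk] <;> norm_num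
    rw [dotProduct, Finset.sum_congr rfl this]
    simp

section HoffmanBound

variable {V : Type*} [Fintype V] [DecidableEq V] (G : SimpleGraph V) [DecidableRel G.Adj]

/-- The Gram matrix `4A + 8I` of the roots is positive definite, so the roots are linearly
independent in `ℝ⁸`. -/
theorem IsE8Representable.card_le (hG : IsE8Representable G) (hmin : -2 < lambdaMin G) :
    Fintype.card V ≤ 8 := by
  obtain ⟨f, -, hroot, hadj, hnadj⟩ := hG
  let M : Matrix V (Fin 8) ℝ := Matrix.of fun v k => (f v k : ℝ)
  have hM : M * Mᵀ = (4 : ℝ) • G.adjMatrix ℝ + (8 : ℝ) • (1 : Matrix V V ℝ) := by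
    ext u v
    have h1 : (M * Mᵀ) u v = ((f u ⬝ᵥ f v : ℤ) : ℝ) := by
      simp [Matrix.mul_apply, M, dotProduct]
    rw [h1]
    by_cases huv : u = v
    · subst huv
      rw [dotProduct_self_of_mem_rootsE8 (hroot u)]
      simp
    · by_cases ha : G.Adj u v
      · rw [hadj u v ha]
        simp [ha, huv]
      · rw [hnadj u v huv ha]
        simp [ha, huv]
  have hli : LinearIndependent ℝ M.row := by
    rw [Fintype.linearIndependent_iff]
    intro g hg
    have hg' : Mᵀ *ᵥ g = 0 := by
      ext k
      have := congrFun hg k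
      simpa [Matrix.mulVec, dotProduct, Finset.sum_apply, mul_comm] using this
    have h0 : g ⬝ᵥ (M * Mᵀ) *ᵥ g = 0 := by
      rw [← Matrix.mulVec_mulVec, hg', Matrix.mulVec_zero, dotProduct_zero]
    rw [hM, Matrix.add_mulVec, Matrix.smul_mulVec, Matrix.smul_mulVec, Matrix.one_mulVec,
      dotProduct_add, dotProduct_smul, dotProduct_smul, smul_eq_mul, smul_eq_mul] at h0
    have h1 := lambdaMin_mul_le G g
    have h2 : 0 ≤ g ⬝ᵥ g := by simpa using dotProduct_star_self_nonneg g
    have h3 : g ⬝ᵥ g = 0 := by nlinarith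
    exact fun i => congrFun (dotProduct_self_eq_zero.1 h3) i
  simpa using hli.fintype_card_le_finrank

theorem IsExceptional.lambdaMin_lt_neg_one (hG : IsExceptional G) : lambdaMin G < -1 := by
  by_contra h
  have := eq_top_of_neg_one_le_lambdaMin G hG.1 (not_lt.1 h)
  subst this
  exact hG.2.2 isGeneralizedLineGraph_top

theorem IsExceptional.exists_adj (hG : IsExceptional G) : ∃ u v, G.Adj u v := by
  by_contra! h
  have : Subsingleton V := by
    refine ⟨fun u v => ?_⟩
    by_contra hne
    have : Nontrivial V := ⟨u, v, hne⟩
    obtain ⟨w, hw⟩ := hG.1.preconnected.exists_adj_of_nontrivial u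
    exact h u w hw
  have htop : G = ⊤ := by
    ext u v
    simp [Subsingleton.elim u v]
  subst htop
  exact hG.2.2 isGeneralizedLineGraph_top

theorem aeval_charpoly_eq_zero_iff {μ : ℝ} :
    Polynomial.aeval μ (G.adjMatrix ℤ).charpoly = 0 ↔ μ ∈ spectrum ℝ (G.adjMatrix ℝ) := by
  have hmap : (G.adjMatrix ℤ).map (algebraMap ℤ ℝ) = G.adjMatrix ℝ := by
    ext u v
    simp [adjMatrix_apply, apply_ite]
  rw [Matrix.mem_spectrum_iff_isRoot_charpoly, ← hmap, Matrix.charpoly_map, Polynomial.IsRoot,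
    Polynomial.eval_map_algebraMap]

/-- The integral characteristic polynomial splits over `ℝ` into factors given by the eigenvalues of
a symmetric matrix. -/
theorem exists_real_of_aeval_charpoly_eq_zero {z : ℂ}
    (hz : Polynomial.aeval z (G.adjMatrix ℤ).charpoly = 0) : ∃ x : ℝ, z = x ∧ lambdaMin G ≤ x := by
  have hA := adjMatrix_isHermitian G
  have hmap : (G.adjMatrix ℤ).map (algebraMap ℤ ℝ) = G.adjMatrix ℝ := by
    ext u v
    simp [adjMatrix_apply, apply_ite]
  have h1 : ((G.adjMatrix ℤ).charpoly.map (algebraMap ℤ ℝ)) =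
      ∏ i, (Polynomial.X - Polynomial.C (hA.eigenvalues i)) := by
    rw [← Matrix.charpoly_map, hmap, hA.charpoly_eq]
    rfl
  have h2 : Polynomial.aeval z ((G.adjMatrix ℤ).charpoly.map (algebraMap ℤ ℝ)) = 0 := by
    rw [Polynomial.aeval_map_algebraMap, hz]
  rw [h1, map_prod, Finset.prod_eq_zero_iff] at h2
  obtain ⟨i, -, hi⟩ := h2
  refine ⟨hA.eigenvalues i, ?_, lambdaMin_le G (hA.eigenvalues_mem_spectrum_real i)⟩
  rw [map_sub, Polynomial.aeval_X, Polynomial.aeval_C] at hi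
  exact sub_eq_zero.1 hi

theorem hoffmanBound_eq_two (h : G.IsBipartite) (hmin : lambdaMin G < 0) : hoffmanBound G = 2 := by
  rw [hoffmanBound, lambdaMax_eq_neg_lambdaMin G h, neg_div, div_self hmin.ne]
  norm_num

theorem IsExceptional.iso_dynkinE_of_hoffmanBound (hG : IsExceptional G)
    (hmin : -2 < lambdaMin G) {m : ℤ} (hm : hoffmanBound G = m) :
    Nonempty (G ≃g dynkinE 6) ∨ Nonempty (G ≃g dynkinE 7) ∨ Nonempty (G ≃g dynkinE 8) := by
  have hcard := hG.2.1.card_le G hmin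
  have hlt := hG.lambdaMin_lt_neg_one G
  obtain ⟨u, v, huv⟩ := hG.exists_adj G
  have hmax := one_le_lambdaMax G huv
  have : Nonempty V := ⟨u⟩
  have hmaxeq : lambdaMax G = -(m - 1 : ℤ) * lambdaMin G := by
    rw [hoffmanBound] at hm
    have h0 : lambdaMin G ≠ 0 := by linarith
    have : lambdaMax G / lambdaMin G = 1 - m := by linarith
    rw [div_eq_iff h0] at this
    rw [this]; push_cast; ring
  have hpos : 0 < m - 1 := by
    by_contra h
    have : ((m - 1 : ℤ) : ℝ) ≤ 0 := by exact_mod_cast not_lt.1 h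
    nlinarith
  -- Here `k = h(G) - 1`, so that `λ_max = -k λ_min`.
  obtain ⟨k, hk⟩ := Int.eq_ofNat_of_zero_le hpos.le
  rw [hk] at hmaxeq hpos
  rw [Int.cast_natCast] at hmaxeq
  have hk1 : 1 ≤ k := by exact_mod_cast hpos
  rcases hk1.eq_or_lt with hk1 | hk2
  · have hlt2 : lambdaMax G < 2 := by rw [hmaxeq, ← hk1]; push_cast; linarith
    refine (isGeneralizedLineGraph_or_dynkinE G hG.1 hcard
      (formPos_of_lambdaMax_lt G (by norm_num) ?_)).resolve_left hG.2.2
    push_cast; linarith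
  · have hgold := golden_of_scaled_conjugates (P := (G.adjMatrix ℤ).charpoly)
      (Matrix.charpoly_monic _) hk2 (fun z hz => exists_real_of_aeval_charpoly_eq_zero G hz)
      ((aeval_charpoly_eq_zero_iff G).2 (lambdaMin_mem_spectrum G))
      ((aeval_charpoly_eq_zero_iff G).2 (hmaxeq ▸ lambdaMax_mem_spectrum G)) hmin hlt
    -- Rational bounds just beyond `φ ≈ 1.618` place `λ_min = -φ` above `-13/8` and `λ_max = 2φ`
    -- below `81/25`, the range of the golden tables.
    have h1 : Real.goldenRatio < 13 / 8 := by
      have := Real.goldenRatio_sq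
      nlinarith [Real.one_lt_goldenRatio]
    have h2 : Real.goldenRatio < 81 / 50 := by
      have := Real.goldenRatio_sq
      nlinarith [Real.one_lt_goldenRatio]
    refine absurd (isGeneralizedLineGraph_of_formPos G hG.1 hcard
      (formPos_of_neg_lambdaMin_lt G (by norm_num) ?_)
      (formPos_of_lambdaMax_lt G (by norm_num) ?_)) hG.2.2
    · rw [hgold.1]; push_cast; linarith
    · rw [hmaxeq, hgold.1, hgold.2]; push_cast; linarith

omit [Fintype V] [DecidableEq V] [DecidableRel G.Adj] in
theorem isBipartite_of_iso_dynkinE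
    (h : Nonempty (G ≃g dynkinE 6) ∨ Nonempty (G ≃g dynkinE 7) ∨ Nonempty (G ≃g dynkinE 8)) :
    G.IsBipartite := by
  rcases h with ⟨⟨φ⟩⟩ | ⟨⟨φ⟩⟩ | ⟨⟨φ⟩⟩
  · exact (dynkinE_isBipartite (n := 6) (by simp)).of_hom φ.toHom
  · exact (dynkinE_isBipartite (n := 7) (by simp)).of_hom φ.toHom
  · exact (dynkinE_isBipartite (n := 8) (by simp)).of_hom φ.toHom

theorem IsExceptional.hoffmanBound_int_iff (hG : IsExceptional G) (hmin : -2 < lambdaMin G) :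
    (∃ m : ℤ, hoffmanBound G = m) ↔
      (Nonempty (G ≃g dynkinE 6) ∨ Nonempty (G ≃g dynkinE 7) ∨ Nonempty (G ≃g dynkinE 8)) := by
  refine ⟨fun ⟨m, hm⟩ => hG.iso_dynkinE_of_hoffmanBound G hmin hm, fun h => ⟨2, ?_⟩⟩
  rw [hoffmanBound_eq_two G (isBipartite_of_iso_dynkinE G h)
    ((hG.lambdaMin_lt_neg_one G).trans (by norm_num))]
  norm_num

theorem IsExceptional.not_isNontriviallyHoffmanColorable (hG : IsExceptional G)
    (hmin : -2 < lambdaMin G) : ¬ IsNontriviallyHoffmanColorable G := by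
  rintro ⟨⟨-, k, -, hk⟩, hbip, -⟩
  exact hbip (isBipartite_of_iso_dynkinE G
    ((hG.hoffmanBound_int_iff G hmin).1 ⟨k, by rw [← hk]; norm_num⟩))

end HoffmanBound

end Exceptional

end HoffmanColoring

theorem mainTheorem5 :
    (∀ {V : Type*} [Fintype V] [DecidableEq V] (G : SimpleGraph V) [DecidableRel G.Adj],
      HoffmanColoring.IsExceptional G → -2 < HoffmanColoring.lambdaMin G →
        ¬ HoffmanColoring.IsNontriviallyHoffmanColorable G ∧
        Fintype.card V ≤ 8 ∧
        ((∃ m : ℤ, HoffmanColoring.hoffmanBound G = (m : ℝ)) ↔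
          (Nonempty (G ≃g HoffmanColoring.dynkinE 6) ∨
            Nonempty (G ≃g HoffmanColoring.dynkinE 7) ∨
            Nonempty (G ≃g HoffmanColoring.dynkinE 8)))) ∧
    (∀ n ∈ ({6, 7, 8} : Set ℕ),
      HoffmanColoring.IsExceptional (HoffmanColoring.dynkinE n) ∧
      -2 < HoffmanColoring.lambdaMin (HoffmanColoring.dynkinE n) ∧
      (HoffmanColoring.dynkinE n).IsBipartite) := by
  refine ⟨fun G _ hG hmin => ⟨hG.not_isNontriviallyHoffmanColorable G hmin,
    hG.2.1.card_le G hmin, hG.hoffmanBound_int_iff G hmin⟩, fun n hn => ?_⟩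
  have hn' : n = 6 ∨ n = 7 ∨ n = 8 := by simpa using hn
  have : Nonempty (Fin n) := ⟨⟨0, by omega⟩⟩
  exact ⟨HoffmanColoring.dynkinE_isExceptional hn',
    HoffmanColoring.lambdaMin_gt_of_forall _ (HoffmanColoring.dynkinE_form_pos hn'),
    HoffmanColoring.dynkinE_isBipartite hn'⟩
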